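/- **The symplectic manifold.** Let $n_1,\dots,n_8=(-1,0),(-1,-1),(0,-1),(1,-1),(1,0),(1,1),(0,1),(-1,1)$ be the outer normals of the octagon $\Delta\subset\mathbb R^2$ with vertices $(0,2),(0,1),(1,0),(2,0),(3,1),(3,2),(2,3),(1,3)$. Let $N\subset (S^1)^8$ be the $6$-torus of all $\theta$ with $\prod_k\theta_k^{(n_k)_1}=\prod_k\theta_k^{(n_k)_2}=1$, acting on $\mathbb C^8$ by $(\theta,z)\mapsto(\theta_1z_1,\dots,\theta_8z_8)$. Let $\mathcal Z\subset\mathbb C^8$ be the $N$-invariant set given by $$|z_1|^2+|z_5|^2=6,\quad |z_2|^2+|z_5|^2+|z_7|^2=10,\quad |z_3|^2+|z_7|^2=6,$$ $$|z_4|^2-|z_5|^2+|z_7|^2=4,\quad |z_5|^2-|z_6|^2+|z_7|^2=2,\quad |z_5|^2-|z_7|^2+|z_8|^2=4 .$$ Let $M=\mathcal Z/N$ be the quotient, a smooth $4$-manifold with charts $\psi_\nu$ ($1\le\nu\le 8$, indices mod $8$) on $U_\nu=\{[z]: z_k\ne0 \text{ for } k\ne \nu,\nu+1\}$ that send $[z]$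 to $(z_\nu,z_{\nu+1})\in\mathbb C^2\cong\mathbb R^4$ for the representative $z$ whose other six coordinates are positive reals. Let $\omega$ be the reduced symplectic form: its pull-back to $\mathcal Z$ is the restriction of $\omega_{st}=-\frac i2\sum_k dz_k\wedge d\bar z_k$. **The system.** Define on $M$ the functions $J([z])=\frac12|z_1|^2$, $H([z])=\frac12|z_3|^2$, $X([z])=\mathrm{Re}(\bar z_2\bar z_3\bar z_4z_6z_7z_8)$, and, for $\gamma,t\in\mathbb R$, $H_t=(1-2t)H+t\gamma X$ and $F_t=(J,H_t)$. Consider the points $$A=[\sqrt2,\sqrt6,\sqrt6,2\sqrt2,2,\sqrt2,0,0],\qquad B=[\sqrt2,0,0,\sqrt2,2,2\sqrt2,\sqrt6,\sqrt6],$$ $$C=[2,2\sqrt2,\sqrt6,\sqrt6,\sqrt2,0,0,\sqrt2],\qquad D=[2,\sqrt2,0,0,\sqrt2,\sqrt6,\sqrt6,2\sqrt2].$$ **Types of fixed points.** A point $p\in M$ is a fixed point (singular point of rank zero) of $F_t$ if $dJ(p)=dH_t(p)=0$. A fixed point $p$ is nondegenerate if the Hessians $d^2J(p)$, $d^2H_t(p)$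 span a Cartan subalgebra of the Lie algebra of quadratic forms on $T_pM$ (identified with $\mathfrak{sp}(T_pM,\omega_p)$ via $\omega_p$), and degenerate otherwise. A nondegenerate fixed point is of elliptic-elliptic type if some real linear combination of $\omega_p^{-1}d^2J(p)$ and $\omega_p^{-1}d^2H_t(p)$ has four distinct eigenvalues $\pm i\alpha,\pm i\beta$, and of focus-focus type if some such combination has four distinct eigenvalues $\pm\alpha\pm i\beta$, where $\alpha,\beta\in\mathbb R\setminus\{0\}$. **Proposition.** Let $0<\gamma<\frac1{48}$ and set $$t^-:=\frac1{2(1+24\gamma)},\qquad t^+:=\frac1{2(1-24\gamma)}.$$ Then $0<t^-<\frac12<t^+<1$, and each of the points $A,B,C,D$ is a fixed point of $F_t$ for all $t\in[0,1]$ which is of elliptic-elliptic type for $0\le t<t^-$ and for $t^+<t\le1$, of focus-focus type for $t^-<t<t^+$ (in particular for $t=\frac12$), and degenerate for $t=t^-$ and for $t=t^+$. -/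

import Mathlib

open scoped Manifold

/-! ## Fixed points of a pair of functions on a 4-dimensional symplectic manifold -/

section LinearAlgebra

variable {V : Type*} [AddCommGroup V] [Module ℝ V]

/-- For a bilinear form `ω` (the symplectic form on a tangent space), the linear map `A ↦ ω(·, A ·)`
from the symplectic Lie algebra `sp(V, ω)` to bilinear forms. For a symplectic form it is the usual
identification of `sp(V, ω)` with the space of symmetric bilinear forms (quadratic forms) on `V`;
the inverse identification is `B ↦ ω⁻¹ B`. -/
def spToForm (ω : LinearMap.BilinForm ℝ V) :
    skewAdjointLieSubalgebra ω →ₗ[ℝ] LinearMap.BilinForm ℝ V where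
  toFun A := ω.compl₂ (A : Module.End ℝ V)
  map_add' A B := by ext u v; simp
  map_smul' c A := by ext u v; simp

/-- The forms `B₁`, `B₂` span a Cartan subalgebra of the Lie algebra of quadratic forms on
`(V, ω)`, the latter being identified with `sp(V, ω)`. -/
def SpanCartan (ω B₁ B₂ : LinearMap.BilinForm ℝ V) : Prop :=
  ∃ 𝔥 : LieSubalgebra ℝ (skewAdjointLieSubalgebra ω), 𝔥.IsCartanSubalgebra ∧
    𝔥.toSubmodule.map (spToForm ω) = Submodule.span ℝ {B₁, B₂}

/-- `C = ω⁻¹ B`: in a basis in which `ω`, `B` have matrices `Ω`, `S` (with `ω(u, v) = uᵀ Ω v`),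
`C` has the matrix `Ω⁻¹ S`. -/
def IsInvComp (ω B : LinearMap.BilinForm ℝ V) (C : Module.End ℝ V) : Prop :=
  ∀ u v, ω u (C v) = B u v

/-- The complex eigenvalues of a real endomorphism, with multiplicity. -/
noncomputable def complexEigenvalues [FiniteDimensional ℝ V] (C : Module.End ℝ V) : Multiset ℂ :=
  (C.charpoly.map (algebraMap ℝ ℂ)).roots

/-- Some linear combination of `ω⁻¹ B₁` and `ω⁻¹ B₂` has four distinct eigenvalues
`± i α`, `± i β` with nonzero real `α`, `β`. -/
def HasEllipticEllipticSpectrum [FiniteDimensional ℝ V]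
    (ω B₁ B₂ : LinearMap.BilinForm ℝ V) : Prop :=
  ∃ (a b : ℝ) (C : Module.End ℝ V), IsInvComp ω (a • B₁ + b • B₂) C ∧
    (complexEigenvalues C).Nodup ∧
    ∃ α β : ℝ, α ≠ 0 ∧ β ≠ 0 ∧
      complexEigenvalues C =
        {Complex.I * α, -(Complex.I * α), Complex.I * β, -(Complex.I * β)}

/-- Some linear combination of `ω⁻¹ B₁` and `ω⁻¹ B₂` has four distinct eigenvalues
`± α ± i β` with nonzero real `α`, `β`. -/
def HasFocusFocusSpectrum [FiniteDimensional ℝ V]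
    (ω B₁ B₂ : LinearMap.BilinForm ℝ V) : Prop :=
  ∃ (a b : ℝ) (C : Module.End ℝ V), IsInvComp ω (a • B₁ + b • B₂) C ∧
    (complexEigenvalues C).Nodup ∧
    ∃ α β : ℝ, α ≠ 0 ∧ β ≠ 0 ∧
      complexEigenvalues C =
        {α + Complex.I * β, α - Complex.I * β, -α + Complex.I * β, -α - Complex.I * β}

end LinearAlgebra

section FixedPoints

variable {E : Type*} [NormedAddCommGroup E] [NormedSpace ℝ E]
  {M : Type*} [TopologicalSpace M] [ChartedSpace E M]

instance tangentSpace_finiteDimensional [FiniteDimensional ℝ E] (p : M) :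
    FiniteDimensional ℝ (TangentSpace 𝓘(ℝ, E) p) :=
  inferInstanceAs (FiniteDimensional ℝ E)

/-- The Hessian of a smooth function at `p`, in the preferred chart at `p` (the chart through which
the tangent space at `p` is identified with the model space `E`). At a critical point of `f` this is
the chart-independent Hessian `d²f(p)`. -/
noncomputable def hessianAt (f : M → ℝ) (p : M) :
    LinearMap.BilinForm ℝ (TangentSpace 𝓘(ℝ, E) p) :=
  ((ContinuousLinearMap.coeLM ℝ).comp
    (fderiv ℝ (fderiv ℝ (f ∘ (chartAt E p).symm)) (chartAt E p p)).toLinearMap :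
      E →ₗ[ℝ] E →ₗ[ℝ] ℝ)

variable (ω : ∀ p : M, LinearMap.BilinForm ℝ (TangentSpace 𝓘(ℝ, E) p)) (f₁ f₂ : M → ℝ) (p : M)

variable (E) in
/-- `p` is a singular point of rank zero of `(f₁, f₂)`: both differentials vanish. -/
def IsFixedPoint : Prop :=
  HasMFDerivAt 𝓘(ℝ, E) 𝓘(ℝ, ℝ) f₁ p 0 ∧ HasMFDerivAt 𝓘(ℝ, E) 𝓘(ℝ, ℝ) f₂ p 0

/-- A nondegenerate fixed point: the Hessians span a Cartan subalgebra of the Lie algebra of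
quadratic forms on the tangent space. -/
def IsNondegenerateFixedPoint : Prop :=
  IsFixedPoint E f₁ f₂ p ∧ SpanCartan (ω p) (hessianAt (E := E) f₁ p) (hessianAt (E := E) f₂ p)

/-- A degenerate fixed point. -/
def IsDegenerateFixedPoint : Prop :=
  IsFixedPoint E f₁ f₂ p ∧ ¬ SpanCartan (ω p) (hessianAt (E := E) f₁ p) (hessianAt (E := E) f₂ p)

/-- A (nondegenerate) fixed point of elliptic-elliptic type. -/
def IsEllipticElliptic [FiniteDimensional ℝ E] : Prop :=
  IsNondegenerateFixedPoint ω f₁ f₂ p ∧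
    HasEllipticEllipticSpectrum (ω p) (hessianAt (E := E) f₁ p) (hessianAt (E := E) f₂ p)

/-- A (nondegenerate) fixed point of focus-focus type. -/
def IsFocusFocus [FiniteDimensional ℝ E] : Prop :=
  IsNondegenerateFixedPoint ω f₁ f₂ p ∧
    HasFocusFocusSpectrum (ω p) (hessianAt (E := E) f₁ p) (hessianAt (E := E) f₂ p)

end FixedPoints

/-! ## The symplectic toric manifold of the octagon

Coordinates `z₁, …, z₈` on `ℂ⁸` are indexed by `Fin 8`, so `z₁` is `z 0` and `z₈` is `z 7`;
index arithmetic in `Fin 8` is cyclic. -/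

namespace Octagon

/-- First coordinates of the outer normals of the octagon, counterclockwise. -/
def nx : Fin 8 → ℤ := ![-1, -1, 0, 1, 1, 1, 0, -1]

/-- Second coordinates of the outer normals of the octagon, counterclockwise. -/
def ny : Fin 8 → ℤ := ![0, -1, -1, -1, 0, 1, 1, 1]

/-- The octagon is `{p | ⟨p, n k⟩ ≤ c k for all k}`. -/
def c : Fin 8 → ℤ := ![0, -1, 0, 2, 3, 5, 3, 2]

/-- The torus `N`, the kernel of the map from the 8-torus to the 2-torus given by the normals. -/
def N : Subgroup (Fin 8 → Circle) where
  carrier := {θ | ∏ k, θ k ^ nx k = 1 ∧ ∏ k, θ k ^ ny k = 1}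
  one_mem' := by simp
  mul_mem' := by
    rintro a b ⟨h1, h2⟩ ⟨h3, h4⟩
    constructor <;> simp [mul_zpow, Finset.prod_mul_distrib, *]
  inv_mem' := by
    rintro a ⟨h1, h2⟩
    constructor <;> simp [Finset.prod_inv_distrib, *]

/-- The zero level in `ℂ⁸` of the momentum map of the action of `N`, given by the manifold
equations. -/
def levelSet : Set (Fin 8 → ℂ) :=
  {z | ‖z 0‖ ^ 2 + ‖z 4‖ ^ 2 = 6 ∧
       ‖z 1‖ ^ 2 + ‖z 4‖ ^ 2 + ‖z 6‖ ^ 2 = 10 ∧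
       ‖z 2‖ ^ 2 + ‖z 6‖ ^ 2 = 6 ∧
       ‖z 3‖ ^ 2 - ‖z 4‖ ^ 2 + ‖z 6‖ ^ 2 = 4 ∧
       ‖z 4‖ ^ 2 - ‖z 5‖ ^ 2 + ‖z 6‖ ^ 2 = 2 ∧
       ‖z 4‖ ^ 2 - ‖z 6‖ ^ 2 + ‖z 7‖ ^ 2 = 4}

/-- `N` acts on the zero level by `(θ, z) ↦ (θ₁ z₁, …, θ₈ z₈)`. -/
noncomputable instance : MulAction N levelSet where
  smul θ z := ⟨fun k => (θ.1 k : ℂ) * z.1 k, by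
    have h := z.2
    simpa only [levelSet, Set.mem_ofPred_eq, norm_mul, Circle.norm_coe, one_mul] using h⟩
  one_smul z := by
    apply Subtype.ext; funext k
    change ((1 : Circle) : ℂ) * z.1 k = z.1 k
    simp
  mul_smul a b z := by
    apply Subtype.ext; funext k
    change ((a.1 k * b.1 k : Circle) : ℂ) * z.1 k = (a.1 k : ℂ) * ((b.1 k : ℂ) * z.1 k)
    push_cast; ring

theorem smul_apply (θ : N) (z : levelSet) (k : Fin 8) :
    (θ • z).1 k = (θ.1 k : ℂ) * z.1 k := rfl

/-- The symplectic quotient `M = levelSet / N`, with the quotient topology. -/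
def M : Type := MulAction.orbitRel.Quotient N levelSet

instance : TopologicalSpace M :=
  inferInstanceAs (TopologicalSpace (Quotient (MulAction.orbitRel N levelSet)))

/-- The quotient map `τ`. -/
noncomputable def τ (z : levelSet) : M := Quotient.mk (MulAction.orbitRel N levelSet) z

theorem isQuotientMap_τ : Topology.IsQuotientMap τ := isQuotientMap_quotient_mk'

theorem τ_eq_iff {z w : levelSet} : τ z = τ w ↔ ∃ θ : N, θ • w = z := by
  exact Iff.trans (Quotient.eq (r := MulAction.orbitRel N levelSet)) MulAction.orbitRel_apply

/-- Descend an `N`-invariant function to `M`. -/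
noncomputable def descend {α : Type*} (f : levelSet → α) (hf : ∀ (θ : N) z, f (θ • z) = f z) : M → α :=
  Quotient.lift f (by
    intro z w h
    obtain ⟨θ, rfl⟩ := MulAction.orbitRel_apply.1 h
    exact hf θ w)

@[simp] theorem descend_τ {α : Type*} (f : levelSet → α) (hf : ∀ (θ : N) z, f (θ • z) = f z)
    (z : levelSet) : descend f hf (τ z) = f z := rfl

/-! ### Charts -/

/-- `n k = coefA ν k • n ν + coefB ν k • n (ν + 1)`. -/
def coefA (ν k : Fin 8) : ℤ := nx k * ny (ν + 1) - ny k * nx (ν + 1)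

/-- See `coefA`. -/
def coefB (ν k : Fin 8) : ℤ := nx ν * ny k - ny ν * nx k

theorem coefA_self (ν : Fin 8) : coefA ν ν = 1 := by decide +revert

theorem coefA_succ (ν : Fin 8) : coefA ν (ν + 1) = 0 := by decide +revert

theorem coefB_self (ν : Fin 8) : coefB ν ν = 0 := by decide +revert

theorem coefB_succ (ν : Fin 8) : coefB ν (ν + 1) = 1 := by decide +revert

theorem coef_nx (ν k : Fin 8) : coefA ν k * nx ν + coefB ν k * nx (ν + 1) = nx k := by
  decide +revert

theorem coef_ny (ν k : Fin 8) : coefA ν k * ny ν + coefB ν k * ny (ν + 1) = ny k := by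
  decide +revert

/-- On the level set, `|z k|²` as an affine function of `r = |z ν|²` and `s = |z (ν + 1)|²`. -/
noncomputable def radSq (ν k : Fin 8) (r s : ℝ) : ℝ :=
  2 * (c k - coefA ν k * c ν - coefB ν k * c (ν + 1)) + coefA ν k * r + coefB ν k * s

theorem mem_levelSet_iff (z : Fin 8 → ℂ) :
    z ∈ levelSet ↔ ∃ x y : ℝ, ∀ k, ‖z k‖ ^ 2 = 2 * (c k - nx k * x - ny k * y) := by
  constructor
  · rintro ⟨h1, h2, h3, h4, h5, h6⟩
    refine ⟨‖z 0‖ ^ 2 / 2, ‖z 2‖ ^ 2 / 2, fun k => ?_⟩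
    fin_cases k <;> simp [c, nx, ny] <;> linarith
  · rintro ⟨x, y, h⟩
    have h0 := h 0; have h1 := h 1; have h2 := h 2; have h3 := h 3
    have h4 := h 4; have h5 := h 5; have h6 := h 6; have h7 := h 7
    simp [c, nx, ny] at h0 h1 h2 h3 h4 h5 h6 h7
    refine ⟨?_, ?_, ?_, ?_, ?_, ?_⟩ <;> linarith

theorem norm_sq_eq_radSq (ν k : Fin 8) {z : Fin 8 → ℂ} (hz : z ∈ levelSet) :
    ‖z k‖ ^ 2 = radSq ν k (‖z ν‖ ^ 2) (‖z (ν + 1)‖ ^ 2) := by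
  obtain ⟨x, y, h⟩ := (mem_levelSet_iff z).1 hz
  have hx : (coefA ν k * nx ν + coefB ν k * nx (ν + 1) : ℝ) = nx k := by
    exact_mod_cast coef_nx ν k
  have hy : (coefA ν k * ny ν + coefB ν k * ny (ν + 1) : ℝ) = ny k := by
    exact_mod_cast coef_ny ν k
  rw [h k, h ν, h (ν + 1), radSq, ← hx, ← hy]
  ring

/-- The map `(z ν, z (ν + 1)) ↦ z` from `ℂ²` to `ℂ⁸` which solves the manifold equations with
nonnegative real values for the other six coordinates; on `target ν` it is `τ_ν⁻¹ ∘ ψ_ν⁻¹`. -/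
noncomputable def lift (ν : Fin 8) (v : ℂ × ℂ) : Fin 8 → ℂ := fun k =>
  if k = ν then v.1 else if k = ν + 1 then v.2
  else ((√(radSq ν k (‖v.1‖ ^ 2) (‖v.2‖ ^ 2)) : ℝ) : ℂ)

/-- The image `V_ν` of the chart `ψ_ν`. -/
def target (ν : Fin 8) : Set (ℂ × ℂ) :=
  {v | ∀ k, k ≠ ν → k ≠ ν + 1 → 0 < radSq ν k (‖v.1‖ ^ 2) (‖v.2‖ ^ 2)}

/-- The points of the level set for which only `z ν` and `z (ν + 1)` may vanish. -/
def upSource (ν : Fin 8) : Set levelSet := {z | ∀ k, k ≠ ν → k ≠ ν + 1 → z.1 k ≠ 0}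

/-- The open set `U_ν` of `M`. -/
def source (ν : Fin 8) : Set M := {p | descend (fun z => z ∈ upSource ν) (by
  intro θ z
  simp [upSource, smul_apply]) p}

theorem τ_mem_source {ν : Fin 8} {z : levelSet} : τ z ∈ source ν ↔ z ∈ upSource ν := Iff.rfl

/-- The phase of a complex number (`0` for the number zero). -/
noncomputable def phase (w : ℂ) : ℂ := w / (‖w‖ : ℂ)

/-- The chart `ψ_ν` in homogeneous coordinates: rotate `z` by the element of `N` that makes the
coordinates other than `z ν`, `z (ν + 1)` positive, and return the two remaining ones. -/
noncomputable def chartUp (ν : Fin 8) (z : Fin 8 → ℂ) : ℂ × ℂ :=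
  (z ν * ∏ k ∈ {ν, ν + 1}ᶜ, phase (z k) ^ coefA ν k,
   z (ν + 1) * ∏ k ∈ {ν, ν + 1}ᶜ, phase (z k) ^ coefB ν k)

theorem prod_split {G : Type*} [CommMonoid G] (ν : Fin 8) (g : Fin 8 → G) :
    ∏ k, g k = g ν * g (ν + 1) * ∏ k ∈ {ν, ν + 1}ᶜ, g k := by
  have hne : ν ≠ ν + 1 := by decide +revert
  rw [← Finset.prod_mul_prod_compl ({ν, ν + 1} : Finset (Fin 8)), Finset.prod_pair hne]

theorem prod_coef (θ : Fin 8 → Circle) (hθ : θ ∈ N) (a b : ℤ) :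
    ∏ k, θ k ^ (nx k * a + ny k * b) = 1 := by
  obtain ⟨h1, h2⟩ := hθ
  simp only [zpow_add, zpow_mul, Finset.prod_mul_distrib, Finset.prod_zpow, h1, h2, one_zpow,
    mul_one]

theorem N_coefA (θ : N) (ν : Fin 8) :
    θ.1 ν * ∏ k ∈ {ν, ν + 1}ᶜ, θ.1 k ^ coefA ν k = 1 := by
  have h := prod_coef θ.1 θ.2 (ny (ν + 1)) (-nx (ν + 1))
  rw [prod_split ν] at h
  have e : ∀ k, nx k * ny (ν + 1) + ny k * -nx (ν + 1) = coefA ν k := by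
    intro k; simp [coefA]; ring
  simpa only [e, coefA_self, coefA_succ, zpow_one, zpow_zero, mul_one] using h

theorem N_coefB (θ : N) (ν : Fin 8) :
    θ.1 (ν + 1) * ∏ k ∈ {ν, ν + 1}ᶜ, θ.1 k ^ coefB ν k = 1 := by
  have h := prod_coef θ.1 θ.2 (-ny ν) (nx ν)
  rw [prod_split ν] at h
  have e : ∀ k, nx k * -ny ν + ny k * nx ν = coefB ν k := by
    intro k; simp [coefB]; ring
  simpa only [e, coefB_self, coefB_succ, zpow_one, zpow_zero, one_mul] using h

theorem phase_mul (θ : Circle) (w : ℂ) : phase (θ * w) = θ * phase w := by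
  simp only [phase, norm_mul, Circle.norm_coe, one_mul, mul_div_assoc]

theorem chartUp_smul (ν : Fin 8) (θ : N) (z : levelSet) :
    chartUp ν (θ • z).1 = chartUp ν z.1 := by
  have hA := congrArg (fun x : Circle => (x : ℂ)) (N_coefA θ ν)
  have hB := congrArg (fun x : Circle => (x : ℂ)) (N_coefB θ ν)
  have key : ∀ s : Finset (Fin 8), ∀ e : Fin 8 → ℤ,
      ((∏ k ∈ s, θ.1 k ^ e k : Circle) : ℂ) = ∏ k ∈ s, (θ.1 k : ℂ) ^ e k := by
    intro s e
    induction s using Finset.induction_on with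
    | empty => simp
    | insert a s ha ih => rw [Finset.prod_insert ha, Finset.prod_insert ha, Circle.coe_mul, ih,
        Circle.coe_zpow]
  simp only [Circle.coe_mul, key, Circle.coe_one] at hA hB
  simp only [chartUp, smul_apply, phase_mul, mul_zpow, Finset.prod_mul_distrib]
  ext1
  · simp only
    rw [mul_mul_mul_comm, hA, one_mul]
  · simp only
    rw [mul_mul_mul_comm, hB, one_mul]

theorem norm_phase {w : ℂ} (h : w ≠ 0) : ‖phase w‖ = 1 := by
  simp [phase, h]

theorem norm_chartUp_fst {ν : Fin 8} {z : levelSet} (hz : z ∈ upSource ν) :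
    ‖(chartUp ν z.1).1‖ = ‖z.1 ν‖ := by
  have : ∏ k ∈ ({ν, ν + 1}ᶜ : Finset (Fin 8)), ‖phase (z.1 k)‖ ^ coefA ν k = 1 := by
    apply Finset.prod_eq_one
    intro k hk
    simp at hk
    rw [norm_phase (hz k hk.1 hk.2), one_zpow]
  simp only [chartUp, norm_mul, norm_prod, norm_zpow, this, mul_one]

theorem norm_chartUp_snd {ν : Fin 8} {z : levelSet} (hz : z ∈ upSource ν) :
    ‖(chartUp ν z.1).2‖ = ‖z.1 (ν + 1)‖ := by
  have : ∏ k ∈ ({ν, ν + 1}ᶜ : Finset (Fin 8)), ‖phase (z.1 k)‖ ^ coefB ν k = 1 := by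
    apply Finset.prod_eq_one
    intro k hk
    simp at hk
    rw [norm_phase (hz k hk.1 hk.2), one_zpow]
  simp only [chartUp, norm_mul, norm_prod, norm_zpow, this, mul_one]

theorem radSq_chartUp {ν : Fin 8} {z : levelSet} (hz : z ∈ upSource ν) (k : Fin 8) :
    radSq ν k (‖(chartUp ν z.1).1‖ ^ 2) (‖(chartUp ν z.1).2‖ ^ 2) = ‖z.1 k‖ ^ 2 := by
  rw [norm_chartUp_fst hz, norm_chartUp_snd hz, ← norm_sq_eq_radSq ν k z.2]

theorem chartUp_mem_target {ν : Fin 8} {z : levelSet} (hz : z ∈ upSource ν) :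
    chartUp ν z.1 ∈ target ν := by
  intro k h1 h2
  rw [radSq_chartUp hz]
  have := hz k h1 h2
  positivity

theorem succ_ne (ν : Fin 8) : ν + 1 ≠ ν := by decide +revert

theorem norm_sq_lift {ν : Fin 8} {v : ℂ × ℂ} (hv : v ∈ target ν) (k : Fin 8) :
    ‖lift ν v k‖ ^ 2 = radSq ν k (‖v.1‖ ^ 2) (‖v.2‖ ^ 2) := by
  unfold lift
  split_ifs with h1 h2
  · subst h1; simp [radSq, coefA_self, coefB_self]
  · subst h2; simp [radSq, coefA_succ, coefB_succ]
  · rw [Complex.norm_real, Real.norm_eq_abs, sq_abs, Real.sq_sqrt (hv k h1 h2).le]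

theorem lift_mem_levelSet {ν : Fin 8} {v : ℂ × ℂ} (hv : v ∈ target ν) :
    lift ν v ∈ levelSet := by
  rw [mem_levelSet_iff]
  refine ⟨ny (ν + 1) * (c ν - ‖v.1‖ ^ 2 / 2) - ny ν * (c (ν + 1) - ‖v.2‖ ^ 2 / 2),
    nx ν * (c (ν + 1) - ‖v.2‖ ^ 2 / 2) - nx (ν + 1) * (c ν - ‖v.1‖ ^ 2 / 2), fun k => ?_⟩
  rw [norm_sq_lift hv]
  simp only [radSq, coefA, coefB]
  push_cast
  ring

theorem lift_mem_upSource {ν : Fin 8} {v : ℂ × ℂ} (hv : v ∈ target ν) :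
    (⟨lift ν v, lift_mem_levelSet hv⟩ : levelSet) ∈ upSource ν := by
  intro k h1 h2 h0
  have h := norm_sq_lift hv k
  have h' := hv k h1 h2
  simp only at h0
  rw [h0] at h
  simp at h
  linarith

theorem phase_lift {ν : Fin 8} {v : ℂ × ℂ} (hv : v ∈ target ν) {k : Fin 8} (h1 : k ≠ ν)
    (h2 : k ≠ ν + 1) : phase (lift ν v k) = 1 := by
  have h := Real.sqrt_pos.2 (hv k h1 h2)
  simp only [phase, lift, h1, h2, if_false, Complex.norm_real, Real.norm_eq_abs, abs_of_pos h]
  exact div_self (by exact_mod_cast h.ne')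

theorem chartUp_lift {ν : Fin 8} {v : ℂ × ℂ} (hv : v ∈ target ν) :
    chartUp ν (lift ν v) = v := by
  have hA : ∀ e : Fin 8 → ℤ,
      ∏ k ∈ ({ν, ν + 1}ᶜ : Finset (Fin 8)), phase (lift ν v k) ^ e k = 1 := by
    intro e
    apply Finset.prod_eq_one
    intro k hk
    simp at hk
    rw [phase_lift hv hk.1 hk.2, one_zpow]
  simp only [chartUp, hA, mul_one]
  simp [lift]

/-- The phase as an element of the circle (`1` for the number zero). -/
noncomputable def cphase (w : ℂ) : Circle := Circle.exp (Complex.arg w)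

theorem norm_mul_cphase (w : ℂ) : (‖w‖ : ℂ) * (cphase w : ℂ) = w := by
  simp [cphase, Circle.coe_exp, Complex.norm_mul_exp_arg_mul_I]

theorem cphase_eq_phase {w : ℂ} (hw : w ≠ 0) : (cphase w : ℂ) = phase w := by
  have h : (‖w‖ : ℂ) ≠ 0 := by simpa using hw
  rw [phase, eq_div_iff h, mul_comm, norm_mul_cphase]

theorem coe_prod_zpow (s : Finset (Fin 8)) (u : Fin 8 → Circle) (e : Fin 8 → ℤ) :
    ((∏ k ∈ s, u k ^ e k : Circle) : ℂ) = ∏ k ∈ s, (u k : ℂ) ^ e k := by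
  induction s using Finset.induction_on with
  | empty => simp
  | insert a s ha ih => rw [Finset.prod_insert ha, Finset.prod_insert ha, Circle.coe_mul, ih,
      Circle.coe_zpow]

/-- The element of the 8-torus that rotates `z` to the section over `U_ν`. -/
noncomputable def rot (ν : Fin 8) (z : Fin 8 → ℂ) : Fin 8 → Circle := fun k =>
  if k = ν then ∏ j ∈ {ν, ν + 1}ᶜ, cphase (z j) ^ coefA ν j
  else if k = ν + 1 then ∏ j ∈ {ν, ν + 1}ᶜ, cphase (z j) ^ coefB ν j
  else (cphase (z k))⁻¹

theorem rot_prod (ν : Fin 8) (z : Fin 8 → ℂ) (e : Fin 8 → ℤ)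
    (he : ∀ k, coefA ν k * e ν + coefB ν k * e (ν + 1) = e k) : ∏ k, rot ν z k ^ e k = 1 := by
  rw [prod_split ν]
  have h1 : rot ν z ν = ∏ j ∈ {ν, ν + 1}ᶜ, cphase (z j) ^ coefA ν j := by simp [rot]
  have h2 : rot ν z (ν + 1) = ∏ j ∈ {ν, ν + 1}ᶜ, cphase (z j) ^ coefB ν j := by
    simp only [rot, succ_ne, if_true, if_false]
  have h3 : ∏ k ∈ {ν, ν + 1}ᶜ, rot ν z k ^ e k
      = ∏ k ∈ {ν, ν + 1}ᶜ, (cphase (z k))⁻¹ ^ e k := by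
    apply Finset.prod_congr rfl
    intro k hk
    simp only [Finset.mem_compl, Finset.mem_insert, Finset.mem_singleton, not_or] at hk
    simp only [rot, hk.1, hk.2, if_false]
  rw [h1, h2, h3, ← Finset.prod_zpow, ← Finset.prod_zpow, ← Finset.prod_mul_distrib,
    ← Finset.prod_mul_distrib]
  apply Finset.prod_eq_one
  intro k _
  rw [← zpow_mul, ← zpow_mul, ← zpow_add, he, inv_zpow, mul_inv_cancel]

theorem rot_mem (ν : Fin 8) (z : Fin 8 → ℂ) : rot ν z ∈ N :=
  ⟨rot_prod ν z nx (coef_nx ν), rot_prod ν z ny (coef_ny ν)⟩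

theorem rot_smul {ν : Fin 8} {z : levelSet} (hz : z ∈ upSource ν) :
    (⟨rot ν z.1, rot_mem ν z.1⟩ : N) • z =
      ⟨lift ν (chartUp ν z.1), lift_mem_levelSet (chartUp_mem_target hz)⟩ := by
  have key : ∀ e : Fin 8 → ℤ, ((∏ j ∈ {ν, ν + 1}ᶜ, cphase (z.1 j) ^ e j : Circle) : ℂ)
      = ∏ j ∈ {ν, ν + 1}ᶜ, phase (z.1 j) ^ e j := by
    intro e
    rw [coe_prod_zpow]
    apply Finset.prod_congr rfl
    intro k hk
    simp only [Finset.mem_compl, Finset.mem_insert, Finset.mem_singleton, not_or] at hk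
    rw [cphase_eq_phase (hz k hk.1 hk.2)]
  apply Subtype.ext
  funext k
  rw [smul_apply]
  simp only [rot, lift]
  split_ifs with h1 h2
  · subst h1
    rw [key, chartUp, mul_comm]
  · subst h2
    rw [key, chartUp, mul_comm]
  · rw [radSq_chartUp hz, Real.sqrt_sq (norm_nonneg _), Circle.coe_inv,
      inv_mul_eq_iff_eq_mul₀ (by simp), mul_comm, norm_mul_cphase]

theorem basePt_mem : lift 0 (0, 0) ∈ levelSet := by
  apply lift_mem_levelSet
  intro k h1 h2
  fin_cases k <;> simp [radSq, coefA, coefB, c, nx, ny] at * <;> norm_num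

open Classical in
/-- The local section of the level set over `V_ν` (with an arbitrary value outside `V_ν`). -/
noncomputable def sec (ν : Fin 8) (v : ℂ × ℂ) : levelSet :=
  if h : v ∈ target ν then ⟨lift ν v, lift_mem_levelSet h⟩
  else ⟨lift 0 (0, 0), basePt_mem⟩

theorem sec_of_mem {ν : Fin 8} {v : ℂ × ℂ} (h : v ∈ target ν) :
    sec ν v = ⟨lift ν v, lift_mem_levelSet h⟩ := dif_pos h

theorem isOpen_source (ν : Fin 8) : IsOpen (source ν) := by
  rw [← isQuotientMap_τ.isOpen_preimage]
  have : τ ⁻¹' source ν = ⋂ k : Fin 8, ⋂ _ : k ≠ ν, ⋂ _ : k ≠ ν + 1, {z | z.1 k ≠ 0} := by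
    ext z
    simp [τ_mem_source, upSource]
  rw [this]
  refine isOpen_iInter_of_finite fun k => isOpen_iInter_of_finite fun _ =>
    isOpen_iInter_of_finite fun _ => isOpen_ne_fun ?_ continuous_const
  exact (continuous_apply k).comp continuous_subtype_val

theorem continuous_radSq (ν k : Fin 8) :
    Continuous fun v : ℂ × ℂ => radSq ν k (‖v.1‖ ^ 2) (‖v.2‖ ^ 2) := by
  unfold radSq; fun_prop

theorem isOpen_target (ν : Fin 8) : IsOpen (target ν) := by
  have : target ν = ⋂ k : Fin 8, ⋂ _ : k ≠ ν, ⋂ _ : k ≠ ν + 1,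
      {v : ℂ × ℂ | 0 < radSq ν k (‖v.1‖ ^ 2) (‖v.2‖ ^ 2)} := by
    ext z
    simp [target]
  rw [this]
  exact isOpen_iInter_of_finite fun k => isOpen_iInter_of_finite fun _ =>
    isOpen_iInter_of_finite fun _ => isOpen_lt continuous_const (continuous_radSq ν k)

theorem continuous_lift (ν : Fin 8) : Continuous (lift ν) := by
  refine continuous_pi fun k => ?_
  unfold lift
  split_ifs
  · exact continuous_fst
  · exact continuous_snd
  · exact Complex.continuous_ofReal.comp (Real.continuous_sqrt.comp (continuous_radSq ν k))

theorem contDiffAt_phase {w : ℂ} (hw : w ≠ 0) : ContDiffAt ℝ (⊤ : ℕ∞) phase w := by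
  have h1 : ContDiffAt ℝ (⊤ : ℕ∞) (fun w : ℂ => ((‖w‖ : ℝ) : ℂ)) w :=
    Complex.ofRealCLM.contDiff.contDiffAt.comp w (contDiffAt_norm ℝ hw)
  have h2 : phase = fun w : ℂ => w * (((‖w‖ : ℝ) : ℂ))⁻¹ := by
    funext w
    exact div_eq_mul_inv _ _
  rw [h2]
  exact contDiffAt_id.mul (h1.fun_inv (by simpa using hw))

theorem contDiffAt_phase_zpow {w : ℂ} (hw : w ≠ 0) (n : ℤ) :
    ContDiffAt ℝ (⊤ : ℕ∞) (fun w => phase w ^ n) w := by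
  have h := contDiffAt_phase hw
  have h0 : phase w ≠ 0 := by
    intro h0
    have := norm_phase hw
    simp [h0] at this
  cases n with
  | ofNat n => simpa using h.pow n
  | negSucc n =>
    simp only [zpow_negSucc]
    exact (h.pow (n + 1)).fun_inv (pow_ne_zero _ h0)

theorem contDiffAt_chartUp {ν : Fin 8} {z : Fin 8 → ℂ}
    (hz : ∀ k, k ≠ ν → k ≠ ν + 1 → z k ≠ 0) : ContDiffAt ℝ (⊤ : ℕ∞) (chartUp ν) z := by
  have key : ∀ (i : Fin 8) (e : Fin 8 → ℤ), ContDiffAt ℝ (⊤ : ℕ∞)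
      (fun z : Fin 8 → ℂ => z i * ∏ k ∈ {ν, ν + 1}ᶜ, phase (z k) ^ e k) z := by
    intro i e
    refine (contDiff_apply ℝ ℂ i).contDiffAt.mul (contDiffAt_prod fun k hk => ?_)
    simp only [Finset.mem_compl, Finset.mem_insert, Finset.mem_singleton, not_or] at hk
    exact (contDiffAt_phase_zpow (hz k hk.1 hk.2) (e k)).comp z
      (contDiff_apply ℝ ℂ k).contDiffAt
  exact (key ν _).prodMk (key (ν + 1) _)

theorem contDiffAt_lift {ν : Fin 8} {v : ℂ × ℂ} (hv : v ∈ target ν) :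
    ContDiffAt ℝ (⊤ : ℕ∞) (lift ν) v := by
  rw [contDiffAt_pi]
  intro k
  unfold lift
  split_ifs with h1 h2
  · exact contDiffAt_fst
  · exact contDiffAt_snd
  · have h : ContDiffAt ℝ (⊤ : ℕ∞)
        (fun v : ℂ × ℂ => radSq ν k (‖v.1‖ ^ 2) (‖v.2‖ ^ 2)) v := by
      unfold radSq
      exact (contDiffAt_const.add (contDiffAt_const.mul (contDiffAt_fst.norm_sq ℝ))).add
        (contDiffAt_const.mul (contDiffAt_snd.norm_sq ℝ))
    exact Complex.ofRealCLM.contDiff.contDiffAt.comp v (h.sqrt (hv k h1 h2).ne')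

/-- The chart `ψ_ν : U_ν → V_ν ⊆ ℂ²`. -/
noncomputable def chart (ν : Fin 8) : OpenPartialHomeomorph M (ℂ × ℂ) where
  toFun := descend (fun z => chartUp ν z.1) (fun θ z => chartUp_smul ν θ z)
  invFun v := τ (sec ν v)
  source := source ν
  target := target ν
  map_source' p hp := by
    obtain ⟨z, rfl⟩ := isQuotientMap_τ.surjective p
    exact chartUp_mem_target hp
  map_target' v hv := by
    rw [sec_of_mem hv]
    exact lift_mem_upSource hv
  left_inv' p hp := by
    obtain ⟨z, rfl⟩ := isQuotientMap_τ.surjective p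
    have hz : z ∈ upSource ν := hp
    rw [descend_τ, sec_of_mem (chartUp_mem_target hz), τ_eq_iff]
    exact ⟨_, rot_smul hz⟩
  right_inv' v hv := by
    rw [sec_of_mem hv, descend_τ]
    exact chartUp_lift hv
  continuousOn_toFun := by
    refine (isQuotientMap_τ.continuousOn_isOpen_iff (isOpen_source ν)).2 ?_
    intro z hz
    exact ((contDiffAt_chartUp hz).continuousAt.comp
      continuous_subtype_val.continuousAt).continuousWithinAt
  continuousOn_invFun := by
    refine isQuotientMap_τ.continuous.comp_continuousOn ?_
    rw [continuousOn_iff_continuous_domRestrict]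
    have : (target ν).domRestrict (sec ν) =
        fun v : target ν => (⟨lift ν v.1, lift_mem_levelSet v.2⟩ : levelSet) := by
      funext v
      exact sec_of_mem v.2
    rw [this]
    exact ((continuous_lift ν).comp continuous_subtype_val).subtype_mk _
  open_source := isOpen_source ν
  open_target := isOpen_target ν

theorem exists_upSource (z : levelSet) : ∃ ν, z ∈ upSource ν := by
  obtain ⟨z, hz⟩ := z
  have hadj : ∀ k j : Fin 8, z k = 0 → j ≠ k → j ≠ k + 1 → j + 1 ≠ k → z j ≠ 0 := by
    obtain ⟨h1, h2, h3, h4, h5, h6⟩ := hz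
    intro k j hk n1 n2 n3 hj
    have p0 := sq_nonneg ‖z 0‖; have p1 := sq_nonneg ‖z 1‖; have p2 := sq_nonneg ‖z 2‖
    have p3 := sq_nonneg ‖z 3‖; have p4 := sq_nonneg ‖z 4‖; have p5 := sq_nonneg ‖z 5‖
    have p6 := sq_nonneg ‖z 6‖; have p7 := sq_nonneg ‖z 7‖
    have hk' : ‖z k‖ ^ 2 = 0 := by rw [hk]; simp
    have hj' : ‖z j‖ ^ 2 = 0 := by rw [hj]; simp
    clear hk hj
    fin_cases k <;> fin_cases j <;> simp at n1 n2 n3 <;> simp only [Fin.reduceFinMk] at hk' hj' <;>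
      first
        | exact absurd rfl n1
        | exact absurd rfl n2
        | exact absurd rfl n3
        | linarith
  have e1 : ∀ j k : Fin 8, j + 1 = k → j ≠ k + 1 + 1 := by decide
  have e2 : ∀ j k : Fin 8, j + 1 = k → j + 1 ≠ k + 1 := by decide
  by_cases h : ∃ k, z k = 0
  · obtain ⟨k, hk⟩ := h
    by_cases h' : z (k + 1) = 0
    · refine ⟨k, fun j h1 h2 => ?_⟩
      by_cases h3 : j + 1 = k
      · exact hadj (k + 1) j h' h2 (e1 j k h3) (e2 j k h3)
      · exact hadj k j hk h1 h2 h3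
    · refine ⟨k - 1, fun j h1 h2 => ?_⟩
      by_cases h3 : j = k + 1
      · subst h3; exact h'
      · refine hadj k j hk (by simpa using h2) h3 ?_
        rintro rfl
        simp at h1
  · push Not at h
    exact ⟨0, fun j _ _ => h j⟩

theorem exists_source (p : M) : ∃ ν, p ∈ source ν := by
  obtain ⟨z, rfl⟩ := isQuotientMap_τ.surjective p
  exact exists_upSource z

/-- The index of the preferred chart at `p`. -/
noncomputable def chartIndex (p : M) : Fin 8 := (exists_source p).choose

noncomputable instance : ChartedSpace (ℂ × ℂ) M where
  atlas := Set.range chart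
  chartAt p := chart (chartIndex p)
  mem_chart_source p := (exists_source p).choose_spec
  chart_mem_atlas _ := ⟨_, rfl⟩

/-- `M` is a smooth manifold of real dimension 4. -/
instance : IsManifold 𝓘(ℝ, ℂ × ℂ) (⊤ : ℕ∞) M := by
  apply isManifold_of_contDiffOn
  rintro _ _ ⟨ν, rfl⟩ ⟨μ, rfl⟩ v hv
  simp only [modelWithCornersSelf_coe, modelWithCornersSelf_coe_symm, Set.range_id,
    Set.inter_univ, Set.preimage_id_eq, id_eq, Function.comp_id, Function.id_comp] at hv ⊢
  have hv1 : v ∈ target ν := hv.1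
  have hv2 : τ (sec ν v) ∈ source μ := hv.2
  rw [sec_of_mem hv1] at hv2
  have h : ContDiffAt ℝ (⊤ : ℕ∞) (chartUp μ ∘ lift ν) v :=
    (contDiffAt_chartUp hv2).comp v (contDiffAt_lift hv1)
  refine (h.congr_of_eventuallyEq ?_).contDiffWithinAt
  filter_upwards [(isOpen_target ν).mem_nhds hv1] with w hw
  change chartUp μ (sec ν w).1 = _
  rw [sec_of_mem hw]
  rfl

/-! ### The symplectic form -/

/-- The standard symplectic form on `ℂ⁸`, with blocks `(0, -1; 1, 0)` in the real coordinates
`(x₁, y₁, …, x₈, y₈)`. -/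
noncomputable def stdForm : LinearMap.BilinForm ℝ (Fin 8 → ℂ) :=
  LinearMap.mk₂ ℝ (fun u v => ∑ k, ((u k).im * (v k).re - (u k).re * (v k).im))
    (by intro u u' v; rw [← Finset.sum_add_distrib]; congr; ext; simp; ring)
    (by intro a u v; rw [smul_eq_mul, Finset.mul_sum]; congr; ext; simp; ring)
    (by intro u v v'; rw [← Finset.sum_add_distrib]; congr; ext; simp; ring)
    (by intro a u v; rw [smul_eq_mul, Finset.mul_sum]; congr; ext; simp; ring)

/-- The reduced symplectic form on `M`, characterised by `τ^* ω = κ^* ω_st` for the inclusion `κ`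
of the level set: at `p`, it is the pull-back of the standard form of `ℂ⁸` under the local section
of `τ` over the preferred chart domain around `p`. -/
noncomputable def symplecticForm (p : M) : LinearMap.BilinForm ℝ (TangentSpace 𝓘(ℝ, ℂ × ℂ) p) :=
  (stdForm.compl₁₂
    (fderiv ℝ (lift (chartIndex p)) (chart (chartIndex p) p)).toLinearMap
    (fderiv ℝ (lift (chartIndex p)) (chart (chartIndex p) p)).toLinearMap :
      (ℂ × ℂ) →ₗ[ℝ] (ℂ × ℂ) →ₗ[ℝ] ℝ)

/-! ### The family of integrable systems -/

/-- `J([z]) = |z₁|² / 2`. -/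
noncomputable def J : M → ℝ := descend (fun z => ‖z.1 0‖ ^ 2 / 2) (by
  intro θ z
  simp only [smul_apply, norm_mul, Circle.norm_coe, one_mul])

/-- `H([z]) = |z₃|² / 2`. -/
noncomputable def H : M → ℝ := descend (fun z => ‖z.1 2‖ ^ 2 / 2) (by
  intro θ z
  simp only [smul_apply, norm_mul, Circle.norm_coe, one_mul])

/-- The function `z ↦ conj z₂ * conj z₃ * conj z₄ * z₆ * z₇ * z₈` on `ℂ⁸`. -/
noncomputable def Z (z : Fin 8 → ℂ) : ℂ :=
  starRingEnd ℂ (z 1) * starRingEnd ℂ (z 2) * starRingEnd ℂ (z 3) * z 5 * z 6 * z 7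

theorem Z_smul (θ : N) (z : levelSet) : Z (θ • z).1 = Z z.1 := by
  have h := θ.2.2
  rw [Fin.prod_univ_eight] at h
  have h' := congrArg (fun x : Circle => (x : ℂ)) h
  simp [ny] at h'
  have e : ∀ k, starRingEnd ℂ (θ.1 k : ℂ) = (θ.1 k : ℂ)⁻¹ := by
    intro k
    rw [← Circle.coe_inv_eq_conj, Circle.coe_inv]
  simp only [Z, smul_apply, map_mul, e]
  linear_combination (starRingEnd ℂ (z.1 1) * starRingEnd ℂ (z.1 2) * starRingEnd ℂ (z.1 3) *
    z.1 5 * z.1 6 * z.1 7) * h'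

/-- `X([z]) = Re Z(z)`. -/
noncomputable def X : M → ℝ := descend (fun z => (Z z.1).re) (by
  intro θ z
  rw [Z_smul])

/-- `H_t = (1 - 2 t) H + t γ X`. -/
noncomputable def Ht (γ t : ℝ) : M → ℝ := fun p => (1 - 2 * t) * H p + t * γ * X p

/-- The transition time `t⁻`. -/
noncomputable def tMinus (γ : ℝ) : ℝ := 1 / (2 * (1 + 24 * γ))

/-- The transition time `t⁺`. -/
noncomputable def tPlus (γ : ℝ) : ℝ := 1 / (2 * (1 - 24 * γ))

/-! ### The four points -/

theorem real_mem_levelSet (x : Fin 8 → ℝ) (h : ∃ a b : ℝ, ∀ k,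
    x k ^ 2 = 2 * (c k - nx k * a - ny k * b)) : (fun k => (x k : ℂ)) ∈ levelSet := by
  rw [mem_levelSet_iff]
  simpa using h

/-- The point `A`, with `z₇ = z₈ = 0`. -/
noncomputable def ptA : M :=
  τ ⟨fun k => ((![√2, √6, √6, 2 * √2, 2, √2, 0, 0] : Fin 8 → ℝ) k : ℂ), real_mem_levelSet _
    ⟨1, 3, fun k => by fin_cases k <;> simp [c, nx, ny, mul_pow] <;> norm_num⟩⟩

/-- The point `B`, with `z₂ = z₃ = 0`. -/
noncomputable def ptB : M :=
  τ ⟨fun k => ((![√2, 0, 0, √2, 2, 2 * √2, √6, √6] : Fin 8 → ℝ) k : ℂ), real_mem_levelSet _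
    ⟨1, 0, fun k => by fin_cases k <;> simp [c, nx, ny, mul_pow] <;> norm_num⟩⟩

/-- The point `C`, with `z₆ = z₇ = 0`. -/
noncomputable def ptC : M :=
  τ ⟨fun k => ((![2, 2 * √2, √6, √6, √2, 0, 0, √2] : Fin 8 → ℝ) k : ℂ), real_mem_levelSet _
    ⟨2, 3, fun k => by fin_cases k <;> simp [c, nx, ny, mul_pow] <;> norm_num⟩⟩

/-- The point `D`, with `z₃ = z₄ = 0`. -/
noncomputable def ptD : M :=
  τ ⟨fun k => ((![2, √2, 0, 0, √2, √6, √6, 2 * √2] : Fin 8 → ℝ) k : ℂ), real_mem_levelSet _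
    ⟨2, 0, fun k => by fin_cases k <;> simp [c, nx, ny, mul_pow] <;> norm_num⟩⟩

end Octagon

/-! Each of the four points is a vertex of the octagon: two adjacent coordinates `z ν`, `z (ν + 1)`
vanish there, so the point is the origin of exactly one chart, with coordinates (v₁, v₂) ∈ ℂ². The
other six coordinates of `lift` depend only on |v₁|², |v₂|², so at the origin ω is the standard form
`planeForm` (`symplecticForm_τ`). Up to constants, J = ε(|v₁|² - |v₂|²)/2 with ε = ±1, H = (a|v₁|² +
b|v₂|²)/2 with a + b = ±1, and X = g(v) Re(v₁v₂) with g(0) = 24, the product of the other four norms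
occurring in Z. Hence the point is fixed, and the Hessians are `quadForm ε (-ε) 0` and `quadForm α β
q` with α = (1 - 2t)a, β = (1 - 2t)b, q = 24γt.

Modulo the first form, the second becomes `quadForm s s q` with s = (α + β)/2 = ±(1 - 2t)/2, so
everything depends on s and q alone. A combination with parameter x has eigenvalues ±i(x ± √(s² -
q²)). For s² > q² these can be made distinct, nonzero and imaginary
(`hasEllipticEllipticSpectrum_quadForm`); for s² < q² they form a quadruple off both axes
(`hasFocusFocusSpectrum_quadForm`). The span is Cartan when s² ≠ q² (`isCartanSubalgebra_torusAlg`),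
and it is not when s² = q² with q ≠ 0 (`not_isCartanSubalgebra_torusAlg`). Finally |1 - 2t|/2 = 24γt
has the two solutions t⁻ and t⁺. -/

namespace Octagon

/-! ### Quadratic forms and Hamiltonian endomorphisms of ℂ². -/

open Complex ComplexConjugate

/-- The symplectic form `∑ Im (u_k * conj v_k)` on `ℂ²`. -/
noncomputable def planeForm : LinearMap.BilinForm ℝ (ℂ × ℂ) :=
  LinearMap.mk₂ ℝ (fun u v => (u.1.im * v.1.re - u.1.re * v.1.im) +
      (u.2.im * v.2.re - u.2.re * v.2.im))
    (by intro u u' v; simp; ring) (by intro a u v; simp; ring)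
    (by intro u v v'; simp; ring) (by intro a u v; simp; ring)

/-- The polarization of `α |v₁|² + β |v₂|² + 2 q Re (v₁ v₂)`. -/
noncomputable def quadForm (α β q : ℝ) : LinearMap.BilinForm ℝ (ℂ × ℂ) :=
  LinearMap.mk₂ ℝ (fun u v => α * (u.1.re * v.1.re + u.1.im * v.1.im) +
      β * (u.2.re * v.2.re + u.2.im * v.2.im) +
      q * (u.1.re * v.2.re - u.1.im * v.2.im + (u.2.re * v.1.re - u.2.im * v.1.im)))
    (by intro u u' v; simp; ring) (by intro a u v; simp; ring)
    (by intro u v v'; simp; ring) (by intro a u v; simp; ring)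

/-- The endomorphism `planeForm⁻¹ (quadForm α β q)`. -/
noncomputable def hamEnd (α β q : ℝ) : Module.End ℝ (ℂ × ℂ) where
  toFun v := (-I * (α * v.1 + q * conj v.2), -I * (β * v.2 + q * conj v.1))
  map_add' u v := by ext1 <;> simp <;> ring
  map_smul' a v := by ext1 <;> simp <;> ring

theorem planeForm_apply (u v : ℂ × ℂ) : planeForm u v =
    (u.1.im * v.1.re - u.1.re * v.1.im) + (u.2.im * v.2.re - u.2.re * v.2.im) := rfl

theorem quadForm_apply (α β q : ℝ) (u v : ℂ × ℂ) : quadForm α β q u v =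
    α * (u.1.re * v.1.re + u.1.im * v.1.im) + β * (u.2.re * v.2.re + u.2.im * v.2.im) +
      q * (u.1.re * v.2.re - u.1.im * v.2.im + (u.2.re * v.1.re - u.2.im * v.1.im)) := rfl

theorem hamEnd_apply (α β q : ℝ) (v : ℂ × ℂ) :
    hamEnd α β q v = (-I * (α * v.1 + q * conj v.2), -I * (β * v.2 + q * conj v.1)) := rfl

theorem smul_quadForm_add_smul (a b α β q α' β' q' : ℝ) :
    a • quadForm α β q + b • quadForm α' β' q' =
      quadForm (a * α + b * α') (a * β + b * β') (a * q + b * q') := by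
  refine LinearMap.ext₂ fun u v => ?_
  simp only [LinearMap.add_apply, LinearMap.smul_apply, quadForm_apply, smul_eq_mul]
  ring

theorem planeForm_hamEnd (α β q : ℝ) : IsInvComp planeForm (quadForm α β q) (hamEnd α β q) := by
  intro u v
  simp [planeForm_apply, quadForm_apply, hamEnd_apply]
  ring

theorem hamEnd_mem (α β q : ℝ) : hamEnd α β q ∈ skewAdjointLieSubalgebra planeForm := by
  change hamEnd α β q ∈ planeForm.skewAdjointSubmodule
  rw [LinearMap.mem_skewAdjointSubmodule]
  intro u v
  simp [planeForm_apply, hamEnd_apply]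
  ring

/-- `hamEnd α β q` as an element of the symplectic Lie algebra. -/
noncomputable def hamLie (α β q : ℝ) : skewAdjointLieSubalgebra planeForm :=
  ⟨hamEnd α β q, hamEnd_mem α β q⟩

theorem spToForm_hamLie (α β q : ℝ) : spToForm planeForm (hamLie α β q) = quadForm α β q :=
  LinearMap.ext₂ fun u v => planeForm_hamEnd α β q u v

theorem spToForm_planeForm_injective : Function.Injective (spToForm planeForm) := by
  intro A B h
  refine Subtype.ext (LinearMap.ext fun v => ?_)
  have h' (u : ℂ × ℂ) : planeForm u (A.1 v) = planeForm u (B.1 v) := LinearMap.congr_fun₂ h u v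
  have h1 := h' (1, 0); have h2 := h' (I, 0); have h3 := h' (0, 1); have h4 := h' (0, I)
  simp [planeForm_apply] at h1 h2 h3 h4
  exact Prod.ext (Complex.ext h2 h1) (Complex.ext h4 h3)

/-! ### The span of the Hessians and the Cartan property. -/

/-- The normal form of the span of the two Hessians. -/
noncomputable def quadSpan (s q : ℝ) : Submodule ℝ (LinearMap.BilinForm ℝ (ℂ × ℂ)) :=
  Submodule.span ℝ {quadForm 1 (-1) 0, quadForm s s q}

/-- A multiple of the first form removes the antisymmetric part (α - β)/2 of the second; only the
mean of α, β survives. Since ε = ±1, it is its own inverse, which gives the witnesses. -/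
theorem span_quadForm {ε : ℝ} (hε : ε ^ 2 = 1) (α β q : ℝ) :
    Submodule.span ℝ {quadForm ε (-ε) 0, quadForm α β q} = quadSpan ((α + β) / 2) q := by
  apply le_antisymm <;> refine Submodule.span_le.2 (Set.pair_subset ?_ ?_) <;>
    refine Submodule.mem_span_pair.2 ?_
  · refine ⟨ε, 0, ?_⟩
    rw [smul_quadForm_add_smul]; congr 1 <;> ring
  · refine ⟨(α - β) / 2, 1, ?_⟩
    rw [smul_quadForm_add_smul]; congr 1 <;> ring
  · refine ⟨ε, 0, ?_⟩
    rw [smul_quadForm_add_smul]; congr 1 <;> linarith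
  · refine ⟨-ε * (α - β) / 2, 1, ?_⟩
    rw [smul_quadForm_add_smul]; congr 1
    · linear_combination (-(α - β) / 2) * hε
    · linear_combination ((α - β) / 2) * hε
    · ring

theorem lie_hamLie_apply (α β q : ℝ) (x : skewAdjointLieSubalgebra planeForm) (v : ℂ × ℂ) :
    (⁅x, hamLie α β q⁆ : skewAdjointLieSubalgebra planeForm).1 v =
      x.1 (hamEnd α β q v) - hamEnd α β q (x.1 v) := rfl

/-- The span of `hamLie 1 (-1) 0` and `hamLie s s q`. -/
noncomputable def torusAlg (s q : ℝ) : LieSubalgebra ℝ (skewAdjointLieSubalgebra planeForm) where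
  toSubmodule := Submodule.span ℝ {hamLie 1 (-1) 0, hamLie s s q}
  lie_mem' := by
    intro x y hx hy
    obtain ⟨a, b, rfl⟩ := Submodule.mem_span_pair.1 hx
    obtain ⟨a', b', rfl⟩ := Submodule.mem_span_pair.1 hy
    -- The form |v₁|² - |v₂|² generates opposite rotations of v₁ and v₂, and these preserve |v₁|²,
    -- |v₂|² and v₁v₂.
    have h : ⁅hamLie 1 (-1) 0, hamLie s s q⁆ = 0 := by
      refine Subtype.ext (LinearMap.ext fun v => ?_)
      rw [lie_hamLie_apply]
      ext <;> simp [hamLie, hamEnd_apply] <;> ring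
    have h' : ⁅hamLie s s q, hamLie 1 (-1) 0⁆ = 0 := by rw [← lie_skew, h, neg_zero]
    simp [h, h']

theorem mem_torusAlg {s q : ℝ} {x : skewAdjointLieSubalgebra planeForm} :
    x ∈ torusAlg s q ↔ ∃ a b : ℝ, hamLie (a + b * s) (-a + b * s) (b * q) = x := by
  refine Submodule.mem_span_pair.trans ?_
  have (a b : ℝ) : a • hamLie 1 (-1) 0 + b • hamLie s s q =
      hamLie (a + b * s) (-a + b * s) (b * q) := by
    refine spToForm_planeForm_injective ?_
    rw [map_add, map_smul, map_smul, spToForm_hamLie, spToForm_hamLie, spToForm_hamLie,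
      smul_quadForm_add_smul]
    congr 1 <;> ring
  simp only [this]

theorem map_torusAlg (s q : ℝ) :
    (torusAlg s q).toSubmodule.map (spToForm planeForm) = quadSpan s q := by
  change Submodule.map _ (Submodule.span ℝ _) = _
  rw [Submodule.map_span, Set.image_pair, spToForm_hamLie, spToForm_hamLie, quadSpan]

/-- By injectivity of `spToForm planeForm`, `torusAlg s q` is the only subalgebra with image
`quadSpan s q`, so the existential in `SpanCartan` has a single candidate. -/
theorem spanCartan_iff {s q : ℝ} {B₁ B₂ : LinearMap.BilinForm ℝ (ℂ × ℂ)}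
    (h : Submodule.span ℝ {B₁, B₂} = quadSpan s q) :
    SpanCartan planeForm B₁ B₂ ↔ (torusAlg s q).IsCartanSubalgebra := by
  rw [SpanCartan, h]
  constructor
  · rintro ⟨𝔥, h1, h2⟩
    rw [← map_torusAlg] at h2
    have := Submodule.map_injective_of_injective spToForm_planeForm_injective h2
    rwa [(LieSubalgebra.toSubmodule_inj _ _).1 this] at h1
  · exact fun h => ⟨_, h, map_torusAlg s q⟩

/-- The reflection `(v₁, v₂) ↦ (conj v₂, conj v₁)`. -/
noncomputable def swapConj : Module.End ℝ (ℂ × ℂ) where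
  toFun v := (conj v.2, conj v.1)
  map_add' u v := by simp
  map_smul' a v := by simp

theorem swapConj_apply (v : ℂ × ℂ) : swapConj v = (conj v.2, conj v.1) := rfl

theorem swapConj_mem : swapConj ∈ skewAdjointLieSubalgebra planeForm := by
  change swapConj ∈ planeForm.skewAdjointSubmodule
  rw [LinearMap.mem_skewAdjointSubmodule]
  intro u v
  simp [planeForm_apply, swapConj_apply]
  ring

/-- The algebra is not self-normalizing: `swapConj`, the endomorphism with quadratic form 2
Im(v₁v₂), normalizes it without belonging to it. -/
theorem not_isCartanSubalgebra_torusAlg {s q : ℝ} (hq : q ≠ 0) (h : s ^ 2 = q ^ 2) :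
    ¬ (torusAlg s q).IsCartanSubalgebra := by
  intro hC
  have h1 : (⟨swapConj, swapConj_mem⟩ : skewAdjointLieSubalgebra planeForm) ∈
      (torusAlg s q).normalizer := by
    rw [LieSubalgebra.mem_normalizer_iff]
    intro y hy
    obtain ⟨a, b, rfl⟩ := mem_torusAlg.1 hy
    -- Bracketing with `swapConj` kills `hamLie 1 (-1) 0` and sends `hamLie s s q` to -2 times
    -- `hamLie q q s`, which is -2s/q times `hamLie s s q` because s² = q².
    refine mem_torusAlg.2 ⟨0, -2 * b * s / q, ?_⟩
    refine Subtype.ext (LinearMap.ext fun v => ?_)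
    have e1 : (-2 * b * s / q * q : ℝ) = -2 * b * s := by field_simp
    have e2 : (-2 * b * s / q * s : ℝ) = -2 * b * q := by
      field_simp
      linear_combination (-b) * h
    rw [lie_hamLie_apply, e1, e2]
    simp only [hamLie, hamEnd_apply, swapConj_apply]
    ext <;> simp <;> ring
  rw [hC.self_normalizing] at h1
  obtain ⟨a, b, h2⟩ := mem_torusAlg.1 h1
  -- On (0, 1) the first component of every `hamEnd` is purely imaginary, while that of `swapConj`
  -- is 1.
  have h3 := congrArg (fun x : skewAdjointLieSubalgebra planeForm => (x.1 (0, 1)).1.re) h2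
  simp [hamLie, hamEnd_apply, swapConj_apply] at h3

/-- The algebra is abelian. An element x of the normalizer is pinned down by its brackets with the
two generators: the first forces it to commute with the rotation, the second forces it into the
algebra. -/
theorem isCartanSubalgebra_torusAlg {s q : ℝ} (h : s ^ 2 ≠ q ^ 2) :
    (torusAlg s q).IsCartanSubalgebra where
  nilpotent := by
    have : IsLieAbelian (torusAlg s q) := ⟨by
      rintro ⟨x, hx⟩ ⟨y, hy⟩
      obtain ⟨a, b, rfl⟩ := mem_torusAlg.1 hx
      obtain ⟨a', b', rfl⟩ := mem_torusAlg.1 hy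
      refine Subtype.ext (Subtype.ext (LinearMap.ext fun v => ?_))
      change (⁅hamLie (a + b * s) (-a + b * s) (b * q),
        hamLie (a' + b' * s) (-a' + b' * s) (b' * q)⁆ : skewAdjointLieSubalgebra planeForm).1 v = 0
      rw [lie_hamLie_apply]
      ext <;> simp [hamLie, hamEnd_apply] <;> ring⟩
    infer_instance
  self_normalizing := by
    refine le_antisymm (fun x hx => ?_) (LieSubalgebra.le_normalizer _)
    rw [LieSubalgebra.mem_normalizer_iff] at hx
    obtain ⟨a, b, h1⟩ := mem_torusAlg.1 (hx (hamLie 1 (-1) 0) (mem_torusAlg.2 ⟨1, 0, by simp⟩))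
    obtain ⟨a', b', h2⟩ := mem_torusAlg.1 (hx (hamLie s s q) (mem_torusAlg.2 ⟨0, 1, by simp⟩))
    have hskew : ∀ u v, planeForm (x.1 u) v = planeForm u (-(x.1 v)) :=
      (LinearMap.mem_skewAdjointSubmodule _).1 x.2
    have h1' (v : ℂ × ℂ) := congrArg (fun y : skewAdjointLieSubalgebra planeForm => y.1 v) h1
    have h2' (v : ℂ × ℂ) := congrArg (fun y : skewAdjointLieSubalgebra planeForm => y.1 v) h2
    simp only [lie_hamLie_apply] at h1' h2'
    have lin (v : ℂ × ℂ) : x.1 v = v.1.re • x.1 (1, 0) + v.1.im • x.1 (I, 0) +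
        v.2.re • x.1 (0, 1) + v.2.im • x.1 (0, I) := by
      rw [← map_smul, ← map_smul, ← map_smul, ← map_smul, ← map_add, ← map_add, ← map_add]
      congr 1
      ext <;> simp
    generalize x.1 (1, 0) = e₁ at lin
    generalize x.1 (I, 0) = e₂ at lin
    generalize x.1 (0, 1) = e₃ at lin
    generalize x.1 (0, I) = e₄ at lin
    obtain ⟨⟨x11, x12⟩, ⟨x13, x14⟩⟩ := e₁
    obtain ⟨⟨x21, x22⟩, ⟨x23, x24⟩⟩ := e₂
    obtain ⟨⟨x31, x32⟩, ⟨x33, x34⟩⟩ := e₃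
    obtain ⟨⟨x41, x42⟩, ⟨x43, x44⟩⟩ := e₄
    have s12 := hskew (1, 0) (I, 0)
    have s13 := hskew (1, 0) (0, 1)
    have s14 := hskew (1, 0) (0, I)
    have s23 := hskew (I, 0) (0, 1)
    have s24 := hskew (I, 0) (0, I)
    have s34 := hskew (0, 1) (0, I)
    have k1 := h1' (1, 0)
    have k2 := h1' (I, 0)
    have k3 := h1' (0, 1)
    have k4 := h1' (0, I)
    have n1 := h2' (1, 0)
    have n3 := h2' (0, 1)
    simp [lin, planeForm_apply, hamLie, hamEnd_apply, Complex.ext_iff] at s12 s13 s14 s23 s24 s34 k1 k2 k3 k4 n1 n3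
    obtain ⟨⟨k11, k12⟩, k13, k14⟩ := k1
    obtain ⟨⟨k21, k22⟩, k23, k24⟩ := k2
    obtain ⟨⟨k31, k32⟩, k33, k34⟩ := k3
    obtain ⟨⟨k41, k42⟩, k43, k44⟩ := k4
    obtain ⟨⟨n11, n12⟩, n13, n14⟩ := n1
    obtain ⟨⟨n31, n32⟩, n33, n34⟩ := n3
    -- [x, `hamLie 1 (-1) 0`] lies in an algebra that commutes with the semisimple `hamLie 1 (-1)
    -- 0`, so it vanishes. Together with skewness this leaves x = `hamEnd (-x12) (-x34) (-x14)` +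
    -- x13 • `swapConj`.
    have z11 : x11 = 0 := by linarith
    have z22 : x22 = 0 := by linarith
    have z33 : x33 = 0 := by linarith
    have z44 : x44 = 0 := by linarith
    have z31 : x13 = x31 := by linarith
    have z24 : x24 = -x13 := by linarith
    have z42 : x42 = -x13 := by linarith
    have z32 : x14 = x32 := by linarith
    have z23 : x14 = x23 := by linarith
    have z41 : x14 = x41 := by linarith
    have z21 : x21 = -x12 := by linarith
    have z43 : x43 = -x34 := by linarith
    subst z11 z22 z33 z44 z31 z24 z42 z32 z23 z41 z21 z43
    -- The `swapConj` part contributes -2 x13 • `hamLie q q s` to the bracket with `hamLie s s q`.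
    -- For this to be a multiple b' of `hamLie s s q` one needs b's = -2 x13 q and b'q = -2 x13 s;
    -- eliminating b' gives the identity.
    have z13 : x13 = 0 := by
      have : (s ^ 2 - q ^ 2) * x13 = 0 := by
        linear_combination (-s / 2) * n14 + (q / 4) * n12 + (q / 4) * n34
      exact (mul_eq_zero.1 this).resolve_left (sub_ne_zero.2 h)
    subst z13
    have hr : s ^ 2 + q ^ 2 ≠ 0 := fun h0 => h (by nlinarith [sq_nonneg s, sq_nonneg q])
    -- Now `n13` says that (-(x12 + x34)/2, -x14) is parallel to (s, q); r is the coefficient of its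
    -- orthogonal projection onto that nonzero vector.
    obtain ⟨r, hrs, hrq⟩ : ∃ r : ℝ, r * s = -(x12 + x34) / 2 ∧ r * q = -x14 := by
      refine ⟨(-(x12 + x34) / 2 * s - x14 * q) / (s ^ 2 + q ^ 2), ?_, ?_⟩
      · field_simp
        linear_combination (-q) * n13
      · field_simp
        linear_combination s * n13
    refine mem_torusAlg.2 ⟨(x34 - x12) / 2, r, ?_⟩
    refine Subtype.ext (LinearMap.ext fun v => ?_)
    rw [hrs, hrq, lin]
    refine Prod.ext (Complex.ext ?_ ?_) (Complex.ext ?_ ?_) <;> simp [hamLie, hamEnd_apply] <;> ring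

/-! ### Spectra of the linear combinations. -/

theorem complexEigenvalues_hamEnd (x s q : ℝ) : complexEigenvalues (hamEnd (x + s) (s - x) q) =
    ((Polynomial.X ^ 2 + Polynomial.C ((x ^ 2 + s ^ 2 - q ^ 2 : ℝ) : ℂ)) ^ 2 -
      Polynomial.C ((4 * x ^ 2 * (s ^ 2 - q ^ 2) : ℝ) : ℂ)).roots := by
  let b : Module.Basis (Fin 4) ℝ (ℂ × ℂ) :=
    (Complex.basisOneI.prod Complex.basisOneI).reindex finSumFinEquiv
  have hM : LinearMap.toMatrix b b (hamEnd (x + s) (s - x) q) =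
      !![0, x + s, 0, -q; -(x + s), 0, -q, 0; 0, -q, 0, s - x; -q, 0, -(s - x), 0] := by
    ext i j
    rw [LinearMap.toMatrix_apply]
    have hb : ⇑b = ![(1, 0), (I, 0), (0, 1), (0, I)] := by
      funext k
      rw [Module.Basis.reindex_apply]
      fin_cases k
      · change Module.Basis.prod _ _ (Sum.inl 0) = _
        simp
      · change Module.Basis.prod _ _ (Sum.inl 1) = _
        simp
      · change Module.Basis.prod _ _ (Sum.inr 0) = _
        simp
      · change Module.Basis.prod _ _ (Sum.inr 1) = _
        simp
    have hr (v : ℂ × ℂ) : b.repr v = ![v.1.re, v.1.im, v.2.re, v.2.im] := by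
      funext k
      rw [Module.Basis.repr_reindex_apply]
      fin_cases k
      · change (Module.Basis.prod _ _).repr v (Sum.inl 0) = _
        simp
      · change (Module.Basis.prod _ _).repr v (Sum.inl 1) = _
        simp
      · change (Module.Basis.prod _ _).repr v (Sum.inr 0) = _
        simp
      · change (Module.Basis.prod _ _).repr v (Sum.inr 1) = _
        simp
    rw [hr, hb]
    fin_cases i <;> fin_cases j <;> simp [hamEnd_apply]
  rw [complexEigenvalues, ← LinearMap.charpoly_toMatrix _ b, hM]
  congr 1
  have hC : Matrix.charmatrix !![0, x + s, 0, -q; -(x + s), 0, -q, 0; 0, -q, 0, s - x;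
      -q, 0, -(s - x), 0] = !![Polynomial.X, -Polynomial.C (x + s), 0, Polynomial.C q;
      Polynomial.C (x + s), Polynomial.X, Polynomial.C q, 0;
      0, Polynomial.C q, Polynomial.X, -Polynomial.C (s - x);
      Polynomial.C q, 0, Polynomial.C (s - x), Polynomial.X] := by
    ext1 i j
    fin_cases i <;> fin_cases j <;> simp
  rw [Matrix.charpoly, hC]
  -- With δ = s² - q², the determinant is (X² + x² + δ)² - 4x²δ, so X² = -(x ± √δ)² at the roots.
  simp [Matrix.det_succ_row_zero, Fin.sum_univ_succ, Fin.succAbove, map_ofNat Polynomial.C]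
  ring

theorem hasEllipticEllipticSpectrum_quadForm {ε : ℝ} (hε : ε ^ 2 = 1) {α β q : ℝ}
    (h : q ^ 2 < ((α + β) / 2) ^ 2) :
    HasEllipticEllipticSpectrum planeForm (quadForm ε (-ε) 0) (quadForm α β q) := by
  set s := (α + β) / 2 with hs
  obtain ⟨r, hr, hr'⟩ : ∃ r : ℝ, 0 < r ∧ r ^ 2 = s ^ 2 - q ^ 2 :=
    ⟨√(s ^ 2 - q ^ 2), Real.sqrt_pos.2 (by linarith), Real.sq_sqrt (by linarith)⟩
  -- The choice x = 2r gives ±i(2r ± r). The values x = 0 and x = r would produce a double or a zero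
  -- eigenvalue.
  have hev : complexEigenvalues (hamEnd (2 * r + s) (s - 2 * r) q) =
      {I * (3 * r : ℝ), -(I * (3 * r : ℝ)), I * r, -(I * r)} := by
    rw [complexEigenvalues_hamEnd, ← Polynomial.roots_multiset_prod_X_sub_C {I * _, _, _, _}]
    congr 1
    simp only [Multiset.insert_eq_cons, Multiset.map_cons, Multiset.map_singleton, Multiset.prod_cons,
      Multiset.prod_singleton]
    rw [add_sub_assoc, ← hr']
    have hI : (Polynomial.C I : Polynomial ℂ) ^ 2 = -1 := by rw [← map_pow]; simp
    simp only [map_mul, map_pow, map_neg, map_add, Complex.ofReal_mul, Complex.ofReal_pow, Complex.ofReal_add, Complex.ofReal_ofNat, map_ofNat]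
    linear_combination (10 * Polynomial.C (r : ℂ) ^ 2 * Polynomial.X ^ 2 +
      9 * Polynomial.C (r : ℂ) ^ 4 * (1 - Polynomial.C I ^ 2)) * hI
  -- The first coefficient changes the antisymmetric part from (α - β)/2 to 2r.
  refine ⟨ε * (2 * r - (α - β) / 2), 1, _, ?_, ?_, 3 * r, r, by positivity, hr.ne', hev⟩
  · rw [smul_quadForm_add_smul]
    convert planeForm_hamEnd (2 * r + s) (s - 2 * r) q using 2
    · linear_combination (2 * r - (α - β) / 2) * hε + hs
    · linear_combination -(2 * r - (α - β) / 2) * hε + hs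
    · ring
  · rw [hev]
    simp [Complex.ext_iff]
    grind

theorem hasFocusFocusSpectrum_quadForm {ε : ℝ} (hε : ε ^ 2 = 1) {α β q : ℝ}
    (h : ((α + β) / 2) ^ 2 < q ^ 2) :
    HasFocusFocusSpectrum planeForm (quadForm ε (-ε) 0) (quadForm α β q) := by
  set s := (α + β) / 2 with hs
  obtain ⟨r, hr, hr'⟩ : ∃ r : ℝ, 0 < r ∧ r ^ 2 = q ^ 2 - s ^ 2 :=
    ⟨√(q ^ 2 - s ^ 2), Real.sqrt_pos.2 (by linarith), Real.sq_sqrt (by linarith)⟩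
  -- Here √(s² - q²) = ir, and x = 1 gives ±i(1 ± ir); any nonzero x would do.
  have hev : complexEigenvalues (hamEnd (1 + s) (s - 1) q) =
      {r + I * (1 : ℝ), r - I * (1 : ℝ), -r + I * (1 : ℝ), -r - I * (1 : ℝ)} := by
    rw [complexEigenvalues_hamEnd, ← Polynomial.roots_multiset_prod_X_sub_C {r + I * _, _, _, _}]
    congr 1
    simp only [Multiset.insert_eq_cons, Multiset.map_cons, Multiset.map_singleton, Multiset.prod_cons,
      Multiset.prod_singleton]
    have hr2 : s ^ 2 - q ^ 2 = - r ^ 2 := by linarith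
    rw [add_sub_assoc, hr2]
    have hI : (Polynomial.C I : Polynomial ℂ) ^ 2 = -1 := by rw [← map_pow]; simp
    simp only [map_mul, map_pow, map_neg, map_add, map_sub, Complex.ofReal_mul, Complex.ofReal_pow, Complex.ofReal_add, Complex.ofReal_ofNat, Complex.ofReal_neg, Complex.ofReal_one, map_one, map_ofNat]
    linear_combination (2 * Polynomial.X ^ 2 + 2 * Polynomial.C (r : ℂ) ^ 2 +
      1 - Polynomial.C I ^ 2) * hI
  refine ⟨ε * (1 - (α - β) / 2), 1, _, ?_, ?_, r, 1, hr.ne', one_ne_zero, hev⟩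
  · rw [smul_quadForm_add_smul]
    convert planeForm_hamEnd (1 + s) (s - 1) q using 2
    · linear_combination (1 - (α - β) / 2) * hε + hs
    · linear_combination -(1 - (α - β) / 2) * hε + hs
    · ring
  · rw [hev]
    simp [Complex.ext_iff]
    grind

end Octagon
-- Hessians of quadratic functions with a variable factor.
open Topology Filter

theorem ContinuousLinearMap.hasFDerivAt_half_self {E : Type*} [NormedAddCommGroup E]
    [NormedSpace ℝ E] (B : E →L[ℝ] E →L[ℝ] ℝ) (hB : ∀ u v, B u v = B v u) (v : E) :
    HasFDerivAt (fun v => B v v / 2) (B v) v := by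
  have h := (B.hasFDerivAt_of_bilinear (hasFDerivAt_id v) (hasFDerivAt_id v)).const_mul (1 / 2)
  refine (h.congr_fderiv ?_).congr_of_eventuallyEq (.of_forall fun w => ?_)
  · ext u
    simp [hB u v]
    ring
  · simp only [id]; ring

/-- The Hessian at `0` of a constant plus a quadratic form plus a multiple of a quadratic form by
a function. -/
theorem hessian_quadratic_add_mul {E : Type*} [NormedAddCommGroup E] [NormedSpace ℝ E]
    {B₁ B₂ : E →L[ℝ] E →L[ℝ] ℝ} (hB₁ : ∀ u v, B₁ u v = B₁ v u) (hB₂ : ∀ u v, B₂ u v = B₂ v u)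
    {f g : E → ℝ} {k : ℝ} (hg : ContDiffAt ℝ 2 g 0)
    (hf : f =ᶠ[𝓝 0] fun v => k + B₁ v v / 2 + g v * (B₂ v v / 2)) :
    HasFDerivAt f (0 : E →L[ℝ] ℝ) 0 ∧ fderiv ℝ (fderiv ℝ f) 0 = B₁ + g 0 • B₂ := by
  have hd : ∀ᶠ v in 𝓝 (0 : E), HasFDerivAt f (B₁ v + (g v • B₂ v + (B₂ v v / 2) • fderiv ℝ g v)) v := by
    filter_upwards [hf.eventuallyEq_nhds, hg.eventually (by simp)] with v hv hgv
    refine HasFDerivAt.congr_of_eventuallyEq ?_ hv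
    exact ((B₁.hasFDerivAt_half_self hB₁ v).const_add k).add
      ((hgv.differentiableAt (by simp)).hasFDerivAt.mul (B₂.hasFDerivAt_half_self hB₂ v))
  refine ⟨by simpa using hd.self_of_nhds, ?_⟩
  have he : fderiv ℝ f =ᶠ[𝓝 0]
      fun v => B₁ v + (g v • B₂ v + (B₂ v v / 2) • fderiv ℝ g v) := by
    filter_upwards [hd] with v hv using hv.fderiv
  rw [he.fderiv_eq]
  have hg' : DifferentiableAt ℝ (fderiv ℝ g) 0 :=
    (hg.fderiv_right (m := 1) (by norm_num)).differentiableAt (by simp)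
  -- Every term containing a derivative of g also carries a factor `B₂ 0` or `B₂ 0 0`, so only `g 0`
  -- survives at the origin.
  have h := (B₁.hasFDerivAt (x := 0)).add
    (((hg.differentiableAt (by simp)).hasFDerivAt.smul (B₂.hasFDerivAt (x := 0))).add
      ((B₂.hasFDerivAt_half_self hB₂ 0).smul hg'.hasFDerivAt))
  refine h.fderiv.trans ?_
  ext u v
  simp

/-! ### Local geometry at a vertex of the octagon. -/

namespace Octagon

open Complex ComplexConjugate

/-- `quadForm` as a continuous bilinear map. -/
noncomputable def quadFormCLM (α β q : ℝ) : (ℂ × ℂ) →L[ℝ] (ℂ × ℂ) →L[ℝ] ℝ :=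
  LinearMap.toContinuousBilinearMap (quadForm α β q)

theorem quadFormCLM_apply (α β q : ℝ) (u v : ℂ × ℂ) :
    quadFormCLM α β q u v = quadForm α β q u v := rfl

theorem quadFormCLM_comm (α β q : ℝ) (u v : ℂ × ℂ) :
    quadFormCLM α β q u v = quadFormCLM α β q v u := by
  simp only [quadFormCLM_apply, quadForm_apply]
  ring

section Vertex

variable {ν : Fin 8} {z : levelSet}

/-- The preferred chart is an arbitrary choice among those containing the point. At a vertex there
is only one, which makes `chartIndex` computable there. -/
theorem eq_of_mem_upSource (h0 : z.1 ν = 0) (h1 : z.1 (ν + 1) = 0) {μ : Fin 8}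
    (h : z ∈ upSource μ) : μ = ν := by
  have h0' : ν = μ ∨ ν = μ + 1 := by
    by_contra! h'
    exact h ν h'.1 h'.2 h0
  have h1' : ν + 1 = μ ∨ ν + 1 = μ + 1 := by
    by_contra! h'
    exact h (ν + 1) h'.1 h'.2 h1
  clear h h0 h1
  revert μ ν
  decide

theorem chartIndex_τ (h0 : z.1 ν = 0) (h1 : z.1 (ν + 1) = 0) : chartIndex (τ z) = ν :=
  eq_of_mem_upSource h0 h1 (τ_mem_source.1 (exists_source (τ z)).choose_spec)

theorem chart_τ (h0 : z.1 ν = 0) (h1 : z.1 (ν + 1) = 0) : chart ν (τ z) = 0 := by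
  change chartUp ν z.1 = 0
  simp [chartUp, h0, h1]

theorem zero_mem_target (ν : Fin 8) : (0 : ℂ × ℂ) ∈ target ν := by
  intro k h1 h2
  -- The vertex satisfies the other six inequalities of the octagon strictly; this is a finite check
  -- over integers.
  have h : 0 < c k - coefA ν k * c ν - coefB ν k * c (ν + 1) := by decide +revert
  have h' : (0 : ℝ) < c k - coefA ν k * c ν - coefB ν k * c (ν + 1) := by exact_mod_cast h
  simp only [radSq, Prod.fst_zero, Prod.snd_zero, norm_zero]
  linarith

/-- The common shape of J and `Ht γ t` in the chart; the nonconstant factor g is needed for X. -/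
theorem hasMFDerivAt_and_hessianAt (h0 : z.1 ν = 0) (h1 : z.1 (ν + 1) = 0) {f : M → ℝ}
    (hf : Continuous f) {k α β : ℝ} {g : ℂ × ℂ → ℝ} (hg : ContDiffAt ℝ 2 g 0)
    (h : ∀ v ∈ target ν, f (τ (sec ν v)) =
      k + (α * ‖v.1‖ ^ 2 + β * ‖v.2‖ ^ 2) / 2 + g v * (v.1 * v.2).re) :
    HasMFDerivAt 𝓘(ℝ, ℂ × ℂ) 𝓘(ℝ, ℝ) f (τ z) 0 ∧
      hessianAt (E := ℂ × ℂ) f (τ z) = quadForm α β (g 0) := by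
  have hc : chartAt (ℂ × ℂ) (τ z) = chart ν := congrArg chart (chartIndex_τ h0 h1)
  have he : (f ∘ (chart ν).symm) =ᶠ[𝓝 0] fun v =>
      k + quadFormCLM α β 0 v v / 2 + g v * (quadFormCLM 0 0 1 v v / 2) := by
    filter_upwards [(isOpen_target ν).mem_nhds (zero_mem_target ν)] with v hv
    refine (h v hv).trans ?_
    simp only [quadFormCLM_apply, quadForm_apply, Complex.sq_norm, Complex.normSq_apply,
      Complex.mul_re]
    ring
  obtain ⟨hd, hh⟩ := hessian_quadratic_add_mul (quadFormCLM_comm _ _ _) (quadFormCLM_comm _ _ _)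
    hg he
  constructor
  · refine ⟨hf.continuousAt, ?_⟩
    simp only [writtenInExtChartAt, extChartAt, mfld_simps, hc, chart_τ h0 h1]
    exact hd.hasFDerivWithinAt
  · rw [hessianAt, hc, chart_τ h0 h1, hh]
    refine LinearMap.ext₂ fun u v => ?_
    change quadFormCLM α β 0 u v + g 0 * quadFormCLM 0 0 1 u v = quadForm α β (g 0) u v
    simp only [quadFormCLM_apply, quadForm_apply]
    ring

/-- The six dependent coordinates are smooth functions of |v₁|² and |v₂|², hence have zero
derivative at the origin. -/
theorem fderiv_lift (ν : Fin 8) (u : ℂ × ℂ) (k : Fin 8) :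
    fderiv ℝ (lift ν) 0 u k = if k = ν then u.1 else if k = ν + 1 then u.2 else 0 := by
  have hd : DifferentiableAt ℝ (lift ν) 0 := (contDiffAt_lift (zero_mem_target ν)).differentiableAt (by simp)
  have hk : fderiv ℝ (lift ν) 0 u k = fderiv ℝ (fun v => lift ν v k) 0 u := by
    rw [fderiv_apply hd]
    rfl
  rw [hk]
  unfold lift
  split_ifs with h1 h2
  · rw [fderiv_fst]; rfl
  · rw [fderiv_snd]; rfl
  · have hr : HasFDerivAt (fun v : ℂ × ℂ => radSq ν k (‖v.1‖ ^ 2) (‖v.2‖ ^ 2))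
        (0 : (ℂ × ℂ) →L[ℝ] ℝ) 0 := by
      unfold radSq
      have := (((hasFDerivAt_fst (𝕜 := ℝ) (p := (0 : ℂ × ℂ))).norm_sq.const_mul
        (coefA ν k : ℝ)).const_add (2 * (c k - coefA ν k * c ν - coefB ν k * c (ν + 1)) : ℝ)).add
        ((hasFDerivAt_snd (𝕜 := ℝ) (p := (0 : ℂ × ℂ))).norm_sq.const_mul (coefB ν k : ℝ))
      exact this.congr_fderiv (by simp)
    have h' : HasFDerivAt (fun v : ℂ × ℂ => ((√(radSq ν k (‖v.1‖ ^ 2) (‖v.2‖ ^ 2)) : ℝ) : ℂ)) _ 0 :=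
      Complex.ofRealCLM.hasFDerivAt.comp (0 : ℂ × ℂ) (hr.sqrt (zero_mem_target ν k h1 h2).ne')
    rw [h'.fderiv]
    simp

theorem symplecticForm_τ (h0 : z.1 ν = 0) (h1 : z.1 (ν + 1) = 0) :
    symplecticForm (τ z) = planeForm := by
  rw [symplecticForm, chartIndex_τ h0 h1, chart_τ h0 h1]
  refine LinearMap.ext₂ fun u v => ?_
  change ∑ k, ((fderiv ℝ (lift ν) 0 u k).im * (fderiv ℝ (lift ν) 0 v k).re -
    (fderiv ℝ (lift ν) 0 u k).re * (fderiv ℝ (lift ν) 0 v k).im) = _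
  simp only [fderiv_lift]
  rw [← Finset.sum_subset (Finset.subset_univ {ν, ν + 1}) (by
    intro k _ hk
    simp only [Finset.mem_insert, Finset.mem_singleton, not_or] at hk
    simp [hk.1, hk.2]), Finset.sum_pair (succ_ne ν).symm]
  simp [planeForm_apply]

end Vertex

end Octagon
-- J and H_t at a transition vertex.
namespace Octagon

open Complex ComplexConjugate

theorem continuous_coord (k : Fin 8) : Continuous fun z : levelSet => z.1 k :=
  (continuous_apply k).comp continuous_subtype_val

theorem continuous_J : Continuous J :=
  isQuotientMap_τ.continuous_iff.2 (by
    change Continuous fun z : levelSet => ‖z.1 0‖ ^ 2 / 2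
    exact ((continuous_coord 0).norm.pow 2).div_const 2)

theorem continuous_H : Continuous H :=
  isQuotientMap_τ.continuous_iff.2 (by
    change Continuous fun z : levelSet => ‖z.1 2‖ ^ 2 / 2
    exact ((continuous_coord 2).norm.pow 2).div_const 2)

theorem continuous_X : Continuous X :=
  isQuotientMap_τ.continuous_iff.2 (by
    change Continuous fun z : levelSet => (Z z.1).re
    have hc (k : Fin 8) : Continuous fun z : levelSet => conj (z.1 k) :=
      Complex.continuous_conj.comp (continuous_coord k)
    exact Complex.continuous_re.comp ((((((hc 1).mul (hc 2)).mul (hc 3)).mul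
      (continuous_coord 5)).mul (continuous_coord 6)).mul (continuous_coord 7)))

theorem continuous_Ht (γ t : ℝ) : Continuous (Ht γ t) :=
  (continuous_H.const_mul _).add (continuous_X.const_mul _)

theorem J_sec {ν : Fin 8} {v : ℂ × ℂ} (hv : v ∈ target ν) :
    J (τ (sec ν v)) = radSq ν 0 (‖v.1‖ ^ 2) (‖v.2‖ ^ 2) / 2 := by
  rw [sec_of_mem hv, ← norm_sq_lift hv]
  rfl

theorem Ht_sec {ν : Fin 8} {v : ℂ × ℂ} (hv : v ∈ target ν) (γ t : ℝ) :
    Ht γ t (τ (sec ν v)) = (1 - 2 * t) * (radSq ν 2 (‖v.1‖ ^ 2) (‖v.2‖ ^ 2) / 2) +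
      t * γ * (Z (lift ν v)).re := by
  rw [sec_of_mem hv, ← norm_sq_lift hv]
  rfl

theorem contDiffAt_sqrt_radSq {ν k : Fin 8} (h1 : k ≠ ν)
    (h2 : k ≠ ν + 1) :
    ContDiffAt ℝ 2 (fun v : ℂ × ℂ => √(radSq ν k (‖v.1‖ ^ 2) (‖v.2‖ ^ 2))) 0 := by
  refine ContDiffAt.sqrt ?_ (zero_mem_target ν k h1 h2).ne'
  unfold radSq
  exact (contDiffAt_const.add (contDiffAt_const.mul (contDiffAt_fst.norm_sq ℝ))).add
    (contDiffAt_const.mul (contDiffAt_snd.norm_sq ℝ))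

/-- A vertex of the octagon at which `J`, `H` and `X` have the local form that leads to the
transitions between elliptic-elliptic and focus-focus type. -/
structure IsTransitionVertex (ν : Fin 8) : Prop where
  coefB_zero : coefB ν 0 = -coefA ν 0
  coefA_zero_sq : coefA ν 0 ^ 2 = 1
  coef_two_sq : (coefA ν 2 + coefB ν 2) ^ 2 = 1
  exists_factor : ∃ g : ℂ × ℂ → ℝ, ContDiffAt ℝ 2 g 0 ∧ g 0 = 24 ∧
    ∀ v, (Z (lift ν v)).re = g v * (v.1 * v.2).re

/-- κ lists the four factors of Z other than the two chart coordinates; the factor g is the product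
of their norms, and 24 = √576 is its value at the vertex. -/
theorem IsTransitionVertex.of_indices {ν : Fin 8} (κ : Fin 4 → Fin 8)
    (hκ : ∀ i, κ i ≠ ν ∧ κ i ≠ ν + 1) (hA : coefB ν 0 = -coefA ν 0) (hA' : coefA ν 0 ^ 2 = 1)
    (hB : (coefA ν 2 + coefB ν 2) ^ 2 = 1)
    (hprod : ∏ i, radSq ν (κ i) 0 0 = 576)
    (hZ : ∀ v, (Z (lift ν v)).re =
      (∏ i, √(radSq ν (κ i) (‖v.1‖ ^ 2) (‖v.2‖ ^ 2))) * (v.1 * v.2).re) :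
    IsTransitionVertex ν where
  coefB_zero := hA
  coefA_zero_sq := hA'
  coef_two_sq := hB
  exists_factor := by
    refine ⟨_, contDiffAt_prod fun i _ => contDiffAt_sqrt_radSq (hκ i).1 (hκ i).2, ?_, hZ⟩
    have h0 (i : Fin 4) : 0 ≤ radSq ν (κ i) 0 0 := by
      simpa using (zero_mem_target ν (κ i) (hκ i).1 (hκ i).2).le
    simp only [Prod.fst_zero, Prod.snd_zero, norm_zero, zero_pow two_ne_zero]
    rw [← Real.sqrt_prod _ fun i _ => h0 i, hprod, show (576 : ℝ) = 24 ^ 2 by norm_num,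
      Real.sqrt_sq (by norm_num)]

/-! ### Type of the fixed point in terms of t and γ. -/

section Vertex

variable {ν : Fin 8} {z : levelSet}

theorem local_J (hν : IsTransitionVertex ν) (h0 : z.1 ν = 0) (h1 : z.1 (ν + 1) = 0) :
    HasMFDerivAt 𝓘(ℝ, ℂ × ℂ) 𝓘(ℝ, ℝ) J (τ z) 0 ∧
      hessianAt (E := ℂ × ℂ) J (τ z) = quadForm (coefA ν 0) (-coefA ν 0) 0 := by
  refine hasMFDerivAt_and_hessianAt h0 h1 continuous_J
    (k := c 0 - coefA ν 0 * c ν - coefB ν 0 * c (ν + 1)) (g := fun _ => 0) contDiffAt_const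
    fun v hv => ?_
  rw [J_sec hv, radSq, hν.coefB_zero]
  push_cast
  ring

theorem local_Ht (hν : IsTransitionVertex ν) (h0 : z.1 ν = 0) (h1 : z.1 (ν + 1) = 0)
    (γ t : ℝ) :
    HasMFDerivAt 𝓘(ℝ, ℂ × ℂ) 𝓘(ℝ, ℝ) (Ht γ t) (τ z) 0 ∧
      hessianAt (E := ℂ × ℂ) (Ht γ t) (τ z) =
        quadForm ((1 - 2 * t) * coefA ν 2) ((1 - 2 * t) * coefB ν 2) (t * γ * 24) := by
  obtain ⟨g, hg, hg0, hgZ⟩ := hν.exists_factor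
  rw [← hg0]
  refine hasMFDerivAt_and_hessianAt h0 h1 (continuous_Ht γ t)
    (k := (1 - 2 * t) * (c 2 - coefA ν 2 * c ν - coefB ν 2 * c (ν + 1)))
    (g := fun v => t * γ * g v) (contDiffAt_const.mul hg) fun v hv => ?_
  rw [Ht_sec hv, radSq, hgZ]
  ring

theorem isFixedPoint_τ (hν : IsTransitionVertex ν) (h0 : z.1 ν = 0) (h1 : z.1 (ν + 1) = 0)
    (γ t : ℝ) : IsFixedPoint (ℂ × ℂ) J (Ht γ t) (τ z) :=
  ⟨(local_J hν h0 h1).1, (local_Ht hν h0 h1 γ t).1⟩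

theorem spanCartan_τ_iff (hν : IsTransitionVertex ν) (h0 : z.1 ν = 0) (h1 : z.1 (ν + 1) = 0)
    (γ t : ℝ) : SpanCartan (symplecticForm (τ z)) (hessianAt (E := ℂ × ℂ) J (τ z))
      (hessianAt (E := ℂ × ℂ) (Ht γ t) (τ z)) ↔
      SpanCartan planeForm (quadForm (coefA ν 0) (-coefA ν 0) 0)
        (quadForm ((1 - 2 * t) * coefA ν 2) ((1 - 2 * t) * coefB ν 2) (t * γ * 24)) := by
  rw [symplecticForm_τ h0 h1, (local_J hν h0 h1).2, (local_Ht hν h0 h1 γ t).2]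
  -- The tangent space unfolds to ℂ × ℂ.
  exact Iff.rfl

theorem half_sq (hν : IsTransitionVertex ν) (p : ℝ) :
    ((p * coefA ν 2 + p * coefB ν 2) / 2) ^ 2 = (p / 2) ^ 2 := by
  have h : ((coefA ν 2 : ℝ) + coefB ν 2) ^ 2 = 1 := by exact_mod_cast hν.coef_two_sq
  linear_combination (p / 2) ^ 2 * h

theorem sq_coefA_zero (hν : IsTransitionVertex ν) : (coefA ν 0 : ℝ) ^ 2 = 1 := by
  exact_mod_cast hν.coefA_zero_sq

theorem isEllipticElliptic_τ (hν : IsTransitionVertex ν) (h0 : z.1 ν = 0) (h1 : z.1 (ν + 1) = 0)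
    {γ t : ℝ} (h : (t * γ * 24) ^ 2 < ((1 - 2 * t) / 2) ^ 2) :
    IsEllipticElliptic symplecticForm J (Ht γ t) (τ z) := by
  rw [← half_sq hν] at h
  refine ⟨⟨isFixedPoint_τ hν h0 h1 γ t, ?_⟩, ?_⟩
  · rw [spanCartan_τ_iff hν h0 h1, spanCartan_iff (span_quadForm (sq_coefA_zero hν) _ _ _)]
    exact isCartanSubalgebra_torusAlg h.ne'
  · rw [symplecticForm_τ h0 h1, (local_J hν h0 h1).2, (local_Ht hν h0 h1 γ t).2]
    exact hasEllipticEllipticSpectrum_quadForm (sq_coefA_zero hν) h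

theorem isFocusFocus_τ (hν : IsTransitionVertex ν) (h0 : z.1 ν = 0) (h1 : z.1 (ν + 1) = 0)
    {γ t : ℝ} (h : ((1 - 2 * t) / 2) ^ 2 < (t * γ * 24) ^ 2) :
    IsFocusFocus symplecticForm J (Ht γ t) (τ z) := by
  rw [← half_sq hν] at h
  refine ⟨⟨isFixedPoint_τ hν h0 h1 γ t, ?_⟩, ?_⟩
  · rw [spanCartan_τ_iff hν h0 h1, spanCartan_iff (span_quadForm (sq_coefA_zero hν) _ _ _)]
    exact isCartanSubalgebra_torusAlg h.ne
  · rw [symplecticForm_τ h0 h1, (local_J hν h0 h1).2, (local_Ht hν h0 h1 γ t).2]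
    exact hasFocusFocusSpectrum_quadForm (sq_coefA_zero hν) h

theorem isDegenerateFixedPoint_τ (hν : IsTransitionVertex ν) (h0 : z.1 ν = 0)
    (h1 : z.1 (ν + 1) = 0) {γ t : ℝ} (hq : t * γ * 24 ≠ 0)
    (h : ((1 - 2 * t) / 2) ^ 2 = (t * γ * 24) ^ 2) :
    IsDegenerateFixedPoint symplecticForm J (Ht γ t) (τ z) := by
  rw [← half_sq hν] at h
  refine ⟨isFixedPoint_τ hν h0 h1 γ t, ?_⟩
  rw [spanCartan_τ_iff hν h0 h1, spanCartan_iff (span_quadForm (sq_coefA_zero hν) _ _ _)]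
  exact not_isCartanSubalgebra_torusAlg hq h

end Vertex

/-- At each point the two vanishing coordinates are either both conjugated in Z or both not, so Z is
a real multiple of v₁v₂ or of its conjugate; the real part is the same. The other four squared norms
are 2, 6, 6, 8 in some order, with product 576. -/
theorem exists_vertex {p : M} (hp : p ∈ ({ptA, ptB, ptC, ptD} : Set M)) :
    ∃ ν, IsTransitionVertex ν ∧ ∃ z : levelSet, τ z = p ∧ z.1 ν = 0 ∧ z.1 (ν + 1) = 0 := by
  rcases hp with rfl | rfl | rfl | rfl
  · refine ⟨6, .of_indices ![1, 2, 3, 5] (by decide) (by decide) (by decide) (by decide) ?_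
      fun v => ?_, _, rfl, by simp, by simp⟩
    · simp [Fin.prod_univ_four, radSq, coefA, coefB, c, nx, ny]; norm_num
    · simp [Fin.prod_univ_four, Z, lift]; ring
  · refine ⟨1, .of_indices ![3, 5, 6, 7] (by decide) (by decide) (by decide) (by decide) ?_
      fun v => ?_, _, rfl, by simp, by simp⟩
    · simp [Fin.prod_univ_four, radSq, coefA, coefB, c, nx, ny]; norm_num
    · simp [Fin.prod_univ_four, Z, lift]; ring
  · refine ⟨5, .of_indices ![1, 2, 3, 7] (by decide) (by decide) (by decide) (by decide) ?_
      fun v => ?_, _, rfl, by simp, by simp⟩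
    · simp [Fin.prod_univ_four, radSq, coefA, coefB, c, nx, ny]; norm_num
    · simp [Fin.prod_univ_four, Z, lift]; ring
  · refine ⟨2, .of_indices ![1, 5, 6, 7] (by decide) (by decide) (by decide) (by decide) ?_
      fun v => ?_, _, rfl, by simp, by simp⟩
    · simp [Fin.prod_univ_four, radSq, coefA, coefB, c, nx, ny]; norm_num
    · simp [Fin.prod_univ_four, Z, lift]; ring

end Octagon

/-! ### The transition times and the conclusion. -/

open Octagon in
theorem mainTheorem5 (γ : ℝ) (hγ : 0 < γ) (hγ' : γ < 1 / 48) :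
    (0 < Octagon.tMinus γ ∧ Octagon.tMinus γ < 1 / 2 ∧
      1 / 2 < Octagon.tPlus γ ∧ Octagon.tPlus γ < 1) ∧
    ∀ p ∈ ({Octagon.ptA, Octagon.ptB, Octagon.ptC, Octagon.ptD} : Set Octagon.M),
      (∀ t : ℝ, 0 ≤ t → t < Octagon.tMinus γ →
        IsEllipticElliptic Octagon.symplecticForm Octagon.J (Octagon.Ht γ t) p) ∧
      (∀ t : ℝ, Octagon.tPlus γ < t → t ≤ 1 →
        IsEllipticElliptic Octagon.symplecticForm Octagon.J (Octagon.Ht γ t) p) ∧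
      (∀ t : ℝ, Octagon.tMinus γ < t → t < Octagon.tPlus γ →
        IsFocusFocus Octagon.symplecticForm Octagon.J (Octagon.Ht γ t) p) ∧
      IsDegenerateFixedPoint Octagon.symplecticForm Octagon.J
        (Octagon.Ht γ (Octagon.tMinus γ)) p ∧
      IsDegenerateFixedPoint Octagon.symplecticForm Octagon.J
        (Octagon.Ht γ (Octagon.tPlus γ)) p := by
  have hm : 0 < 2 * (1 + 24 * γ) := by linarith
  have hp : 0 < 2 * (1 - 24 * γ) := by linarith
  have hm' : tMinus γ * (2 * (1 + 24 * γ)) = 1 := one_div_mul_cancel hm.ne'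
  have hp' : tPlus γ * (2 * (1 - 24 * γ)) = 1 := one_div_mul_cancel hp.ne'
  have hm0 : 0 < tMinus γ := by rw [tMinus]; positivity
  -- The denominator of t⁺ is below 2 as γ > 0, and above 1 as γ < 1/48; the latter is what gives t⁺
  -- < 1.
  have hp0 : 1 / 2 < tPlus γ := by nlinarith
  refine ⟨⟨hm0, by nlinarith, hp0, by nlinarith⟩, fun p hpt => ?_⟩
  obtain ⟨ν, hν, z, rfl, h0, h1⟩ := exists_vertex hpt
  refine ⟨fun t ht ht' => ?_, fun t ht ht' => ?_, fun t ht ht' => ?_, ?_, ?_⟩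
  · refine isEllipticElliptic_τ hν h0 h1 (sq_lt_sq' ?_ ?_)
    · nlinarith [mul_nonneg ht hγ.le]
    · nlinarith
  · refine isEllipticElliptic_τ hν h0 h1 (sq_lt_sq.2 ?_)
    rw [abs_of_nonneg (by nlinarith [mul_pos (one_half_pos.trans (hp0.trans ht)) hγ]), abs_of_neg (by linarith)]
    nlinarith
  · refine isFocusFocus_τ hν h0 h1 (sq_lt_sq' ?_ ?_) <;> nlinarith
  · refine isDegenerateFixedPoint_τ hν h0 h1 (by positivity) ?_
    congr 1
    linear_combination (-1 / 2) * hm'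
  · refine isDegenerateFixedPoint_τ hν h0 h1 ?_ ?_
    · have : 0 < tPlus γ := by linarith
      positivity
    -- Since t⁺ > 1/2, the number (1 - 2t⁺)/2 is the negative of 24γt⁺, whereas at t⁻ the two agree
    -- without a sign change.
    · rw [← neg_sq]
      congr 1
      linear_combination (1 / 2) * hp'
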